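/- Let $M\ge 4$ and $K>4$ be integers, $\gamma,\sigma>0$, and let $\mathbf h_1,\dots,\mathbf h_K\in\mathbb C^M$ be random channel vectors with i.i.d. circularly symmetric complex Gaussian entries of mean $0$ and variance $1$. Semi-orthogonal user selection (SUS) selects four distinct users $s_1,s_2,s_3,s_4$ (depending measurably on the outcome): $s_i$ is, among the users not selected before, one whose channel has the largest projection on the orthogonal complement of $\mathrm{span}(\mathbf h_{s_1},\dots,\mathbf h_{s_{i-1}})$. For large SINR targets, the minimum instantaneous transmit power needed by the selected users, each with SINR target $\gamma$ and noise variance $\sigma^2$, is $$p_{\mathrm{tx}}=\sigma^2\sum_{i=1}^{4}\frac{\gamma}{\|\mathbf h_{s_i}\|^2\sin^2\theta_{i-1}},$$ where $\theta_{i-1}$ is the angle between $\mathbf h_{s_i}$ and $\mathrm{span}(\mathbf h_{s_1},\dots,\mathbf h_{s_{i-1}})$ ($\theta_0=\pi/2$). For integers $m,k\ge 1$ put $$G(m,x)=\frac1{\Gamma(m)}\int_0^x e^{-t}t^{m-1}\,dt,\qquad \alpha_{m,k}=\int_0^\infty k\,\frac{e^{-x}x^{m-2}}{\Gamma(m)}\,[G(m,x)]^{k-1}\,dx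 .$$ For $i=1,\dots,4$ let $X_i$ be the $i$-th largest of the squared norms of $K$ independent vectors in $\mathbb C^{M+1-i}$ with i.i.d. complex Gaussian entries of mean $0$ and variance $1$, and let $$p_{\mathrm S}(4)=\sigma^2\gamma\sum_{i=1}^{4}\mathbb E\Big[\frac1{X_i}\Big]$$ be the average minimum transmit power for SUS with four users, in which the projected energy $\|\mathbf h_{s_i}\|^2\sin^2\theta_{i-1}$ of the $i$-th selected user is replaced by $X_i$. Then all these expectations, and all the constants $\alpha_{m,k}$ below, are finite, and $$\begin{aligned} p_{\mathrm S}(4)=\gamma\sigma^2\Big[&\alpha_{M,K}+K\alpha_{M-1,K-1}-(K-1)\alpha_{M-1,K}\\ &+\tfrac{K(K-1)}2\alpha_{M-2,K-2}-K(K-2)\alpha_{M-2,K-1}+\tfrac{(K-1)(K-2)}2\alpha_{M-2,K}\\ &+\tfrac{K(K-1)(K-2)}6\alpha_{M-3,K-3}-\tfrac{K(K-1)(K-3)}2\alpha_{M-3,K-2}\\ &+\tfrac{K(K-2)(K-3)}2\alpha_{M-3,K-1}-\tfrac{(K-1)(K-2)(K-3)}6\alpha_{M-3,K}\Big]. \end{aligned}$$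 Moreover $p_{\mathrm{tx}}$ is integrable and $\mathbb E[p_{\mathrm{tx}}]\le p_{\mathrm S}(4)$. -/

import Mathlib

open MeasureTheory ProbabilityTheory

noncomputable section

namespace SUSPower

/-- The regularized Gamma function `G(m, x) = (1 / Γ(m)) ∫₀ˣ e^{-t} t^{m-1} dt`. -/
def regGamma (m : ℕ) (x : ℝ) : ℝ :=
  (1 / Real.Gamma m) * ∫ t in (0 : ℝ)..x, Real.exp (-t) * t ^ ((m : ℝ) - 1)

/-- The integrand `k e^{-x} x^{m-2} / Γ(m) · G(m, x)^{k-1}` of `α_{m,k}`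
(for `k ≥ 1`; the exponent `m - 2` is a real number and may be `-1`). -/
def alphaIntegrand (m k : ℕ) (x : ℝ) : ℝ :=
  k * (Real.exp (-x) * x ^ ((m : ℝ) - 2) / Real.Gamma m) * regGamma m x ^ (k - 1)

/-- The constant `α_{m,k} = ∫₀^∞ k e^{-x} x^{m-2} / Γ(m) · G(m, x)^{k-1} dx`. -/
def alpha (m k : ℕ) : ℝ :=
  ∫ x in Set.Ioi (0 : ℝ), alphaIntegrand m k x

/-- The circularly symmetric complex Gaussian law with mean `0` and variance `1`: the real and
imaginary parts are independent, each real Gaussian with mean `0` and variance `1 / 2`. -/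
def stdComplexGaussian : Measure ℂ :=
  ((gaussianReal 0 (1 / 2)).prod (gaussianReal 0 (1 / 2))).map
    (fun p : ℝ × ℝ => (⟨p.1, p.2⟩ : ℂ))

/-- The joint law of `K` independent vectors in `ℂ^m` with i.i.d. standard complex Gaussian
entries. -/
def gaussianVectors (K m : ℕ) : Measure (Fin K → Fin m → ℂ) :=
  Measure.pi fun _ => Measure.pi fun _ => stdComplexGaussian

/-- The descending order statistics of a finite family of reals: `descOrderStat v r` is the
`(r + 1)`-st largest of the values `v 0, …, v (K - 1)`, counted with multiplicity. -/
def descOrderStat {K : ℕ} (v : Fin K → ℝ) (r : Fin K) : ℝ :=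
  v (Tuple.sort v (Fin.rev r))

/-- The `(r + 1)`-st largest of the squared Euclidean norms of `K` vectors in `ℂ^m`. -/
def normSqOrderStat {K m : ℕ} (r : Fin K) (g : Fin K → Fin m → ℂ) : ℝ :=
  descOrderStat (fun k => ‖(WithLp.toLp 2 (g k) : EuclideanSpace ℂ (Fin m))‖ ^ 2) r

/-- The average power `p_S(Ks) = σ² γ ∑_{i=1}^{Ks} E[1 / X_i]`, where `X_i` is the `i`-th largest
of the squared norms of `K` independent standard complex Gaussian vectors of dimension
`M + 1 - i`. The summation index below is `i - 1`. -/
def susAveragePower (M K Ks : ℕ) (hKs : Ks ≤ K) (σ γ : ℝ) : ℝ :=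
  σ ^ 2 * γ * ∑ i : Fin Ks,
    ∫ g, (normSqOrderStat (Fin.castLE hKs i) g)⁻¹ ∂(gaussianVectors K (M - i))

/-- The energy of the projection of `x` on the orthogonal complement of `U`, that is
`‖x‖² sin² θ` with `θ` the angle between `x` and the subspace `U`. -/
def projEnergy {M : ℕ} (U : Submodule ℂ (EuclideanSpace ℂ (Fin M)))
    (x : EuclideanSpace ℂ (Fin M)) : ℝ :=
  ‖Uᗮ.starProjection x‖ ^ 2

/-- The subspace spanned by the channels of the users that come before `i`. -/
def prevSpan {M Ks : ℕ} (c : Fin Ks → EuclideanSpace ℂ (Fin M)) (i : Fin Ks) :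
    Submodule ℂ (EuclideanSpace ℂ (Fin M)) :=
  Submodule.span ℂ (c '' Set.Iio i)

/-- The list `s` of users is an outcome of semi-orthogonal user selection for the channels `H`:
each `s i` is, among the users not selected before, one whose channel has the largest
projection on the orthogonal complement of the span of the previously selected channels. -/
def IsSUSSelection {M K Ks : ℕ} (H : Fin K → EuclideanSpace ℂ (Fin M))
    (s : Fin Ks → Fin K) : Prop :=
  ∀ i : Fin Ks, (∀ j < i, s j ≠ s i) ∧
    ∀ k : Fin K, (∀ j < i, s j ≠ k) →
      projEnergy (prevSpan (fun j => H (s j)) i) (H k) ≤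
        projEnergy (prevSpan (fun j => H (s j)) i) (H (s i))

/-- The minimum instantaneous transmit power, in its form for large SINR targets, for users with
channels `c 0, c 1, …`, common SINR target `γ` and noise variance `σ²`:
`σ² ∑ i, γ / (‖c i‖² sin² θ i)`, with `θ i` the angle between `c i` and the span of the channels
of the earlier users. -/
def instPower {M Ks : ℕ} (σ γ : ℝ) (c : Fin Ks → EuclideanSpace ℂ (Fin M)) : ℝ :=
  σ ^ 2 * ∑ i, γ / projEnergy (prevSpan c i) (c i)

/-- The closed-form value of the average power for four selected users. -/
def susFourFormula (M K : ℕ) (σ γ : ℝ) : ℝ :=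
  γ * σ ^ 2 *
    (alpha M K
      + K * alpha (M - 1) (K - 1) - (K - 1) * alpha (M - 1) K
      + K * (K - 1) / 2 * alpha (M - 2) (K - 2) - K * (K - 2) * alpha (M - 2) (K - 1)
      + (K - 1) * (K - 2) / 2 * alpha (M - 2) K
      + K * (K - 1) * (K - 2) / 6 * alpha (M - 3) (K - 3)
      - K * (K - 1) * (K - 3) / 2 * alpha (M - 3) (K - 2)
      + K * (K - 2) * (K - 3) / 2 * alpha (M - 3) (K - 1)
      - (K - 1) * (K - 2) * (K - 3) / 6 * alpha (M - 3) K)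

end SUSPower

end

/-!
The law of the `i`-th largest of `K` independent variables with continuous distribution function
`F` and density `f` has density `K C(K-1,i-1) f (1-F)^(i-1) F^(K-i)`. The squared norm of a standard
Gaussian vector in `ℂ^m` has the Gamma law of shape `m`, whose distribution function is `G(m, ·)`.
Expanding the power of `1 - F` turns `E[1 / X_i]` into the combination of the constants `α_{m,k}`
of the formula (`meanInvOrderStat_spec`). For `m = 1` the singularity `x⁻¹` of the integrand is
compensated by `G(1, x) ≤ x`.

For the upper bound, fix a possible outcome `t` of the selection and triangularize the channels by
Householder reflections: step `j` reflects every vector except the pivot `H (t j)`, by a reflection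
that is `-1` on the span of the first `j` basis vectors and takes the pivot into the span of the
first `j + 1` basis vectors. Two facts carry the argument.

* The vectors that have not yet been pivots are all moved by one and the same unitary map, which
  takes the span of the pivots to the span of the first basis vectors. So the projected energies
  that the algorithm compares are the energies of the coordinates from `j` on (the tails) of the
  triangularized vectors (`projEnergy_prevSpan_eq`), and if the outcome is `t`, then `t` is a greedy
  selection for these tail energies (`isGreedy_triang`).
* The reflection of step `j` depends on the pivot only, the pivot is not moved and is independent of
  the other vectors, and the Gaussian law is unitarily invariant. So the triangularized vectors are
  again i.i.d. standard Gaussian (`measurePreserving_rotIter`), whatever `t` is.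

A user that is greedily selected in round `i` has the largest energy outside a set of `i - 1` users,
hence at least the `i`-th largest energy of all `K` users (`IsGreedy.descOrderStat_le`). For i.i.d.
Gaussian vectors there are almost surely no ties, so that the greedy events of distinct `t` are
disjoint, and the sum over `t` of the means of the inverse of the `i`-th largest tail energy on
these events is at most `E[1 / X_i]` (`lintegral_inv_selEnergy_le`).
-/

noncomputable section

namespace SUSPower

open Set
open scoped ENNReal InnerProductSpace

/-! ### Gaussian vectors: density, unitary invariance and law of the norm -/

theorem lintegral_pi_prod_eq_prod {α : Type*} [MeasurableSpace α] (μ : Measure α) [SigmaFinite μ] :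
    ∀ (n : ℕ) (f : Fin n → α → ℝ≥0∞), (∀ i, Measurable (f i)) →
      ∫⁻ x, ∏ i, f i (x i) ∂(Measure.pi fun _ : Fin n => μ) = ∏ i, ∫⁻ y, f i y ∂μ
  | 0, f, _ => by simp
  | n + 1, f, hf => by
    have hmp := (measurePreserving_piFinSuccAbove (fun _ : Fin (n + 1) => μ) 0).symm
    rw [← hmp.lintegral_comp (by fun_prop)]
    simp only [Fin.prod_univ_succ, MeasurableEquiv.piFinSuccAbove_symm_apply,
      Fin.insertNthEquiv_zero, Fin.consEquiv_apply, Fin.cons_zero, Fin.cons_succ]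
    rw [lintegral_prod_mul (f := f 0) (g := fun y : Fin n → α => ∏ i, f i.succ (y i))
      (hf 0).aemeasurable
      (Finset.measurable_fun_prod _ fun i _ => (hf _).comp (measurable_pi_apply i)).aemeasurable]
    rw [lintegral_pi_prod_eq_prod μ n (fun i => f i.succ) (fun i => hf _)]

theorem pi_withDensity {α : Type*} [MeasurableSpace α] (μ : Measure α) [SigmaFinite μ]
    (n : ℕ) (f : α → ℝ≥0∞) (hf : Measurable f) [SigmaFinite (μ.withDensity f)] :
    Measure.pi (fun _ : Fin n => μ.withDensity f) =
      (Measure.pi fun _ : Fin n => μ).withDensity fun x => ∏ i, f (x i) := by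
  refine Measure.pi_eq fun s hs => ?_
  rw [withDensity_apply _ (.univ_pi hs), ← lintegral_indicator (.univ_pi hs)]
  have : (univ.pi s).indicator (fun x : Fin n → α => ∏ i, f (x i)) =
      fun x => ∏ i, (s i).indicator f (x i) := by
    ext x
    by_cases hx : x ∈ univ.pi s
    · rw [indicator_of_mem hx]
      exact Finset.prod_congr rfl fun i _ => (indicator_of_mem (hx i trivial) f).symm
    · rw [indicator_of_notMem hx]
      simp only [mem_pi, mem_univ, true_imp_iff, not_forall] at hx
      obtain ⟨i, hi⟩ := hx
      exact (Finset.prod_eq_zero (Finset.mem_univ i) (indicator_of_notMem hi f)).symm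
  rw [this, lintegral_pi_prod_eq_prod μ n _ fun i => hf.indicator (hs i)]
  exact Finset.prod_congr rfl fun i _ => by
    rw [withDensity_apply _ (hs i), lintegral_indicator (hs i)]

/-- The density of `stdComplexGaussian`. -/
theorem stdComplexGaussian_eq_withDensity :
    stdComplexGaussian =
      volume.withDensity fun z : ℂ => ENNReal.ofReal (Real.pi⁻¹ * Real.exp (-‖z‖ ^ 2)) := by
  have h2 : (1 / 2 : NNReal) ≠ 0 := by norm_num
  have hm : Measurable fun p : ℝ × ℝ => (⟨p.1, p.2⟩ : ℂ) :=
    Complex.measurableEquivRealProd.symm.measurable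
  have hvol : (volume : Measure ℂ) = (volume : Measure (ℝ × ℝ)).map
      (fun p : ℝ × ℝ => (⟨p.1, p.2⟩ : ℂ)) :=
    (Complex.volume_preserving_equiv_real_prod.symm).map_eq.symm
  rw [stdComplexGaussian, gaussianReal_of_var_ne_zero _ h2,
    prod_withDensity (measurable_gaussianPDF _ _) (measurable_gaussianPDF _ _), hvol]
  ext s hs
  rw [Measure.map_apply hm hs, withDensity_apply _ (hm hs), withDensity_apply _ hs,
    setLIntegral_map hs (by fun_prop) hm]
  refine lintegral_congr fun p => ?_
  rw [gaussianPDF, gaussianPDF, ← ENNReal.ofReal_mul (gaussianPDFReal_nonneg _ _ _)]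
  congr 1
  have hs2 : (√(2 * Real.pi * ((1 / 2 : NNReal) : ℝ)))⁻¹ *
      (√(2 * Real.pi * ((1 / 2 : NNReal) : ℝ)))⁻¹ = Real.pi⁻¹ := by
    rw [← mul_inv, Real.mul_self_sqrt (by positivity)]
    congr 1
    push_cast
    ring
  rw [gaussianPDFReal, gaussianPDFReal, mul_mul_mul_comm, hs2, ← Real.exp_add]
  congr 2
  rw [Complex.sq_norm, Complex.normSq_mk]
  push_cast
  ring

instance : IsProbabilityMeasure stdComplexGaussian := by
  have hm : Measurable fun p : ℝ × ℝ => (⟨p.1, p.2⟩ : ℂ) :=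
    Complex.measurableEquivRealProd.symm.measurable
  exact Measure.isProbabilityMeasure_map hm.aemeasurable

instance : NullSingletonClass stdComplexGaussian := by
  rw [stdComplexGaussian_eq_withDensity]; infer_instance

/-- The law of a standard complex Gaussian vector, on the Euclidean space `ℂ^m`. -/
def gaussianVector (m : ℕ) : Measure (EuclideanSpace ℂ (Fin m)) :=
  (Measure.pi fun _ => stdComplexGaussian).map (WithLp.toLp 2)

instance (m : ℕ) : IsProbabilityMeasure (gaussianVector m) :=
  Measure.isProbabilityMeasure_map (by fun_prop)

/-- Lebesgue measure on `ℂ^m`, transported to the Euclidean space. -/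
def euclideanHaar (m : ℕ) : Measure (EuclideanSpace ℂ (Fin m)) :=
  (Measure.pi fun _ => volume).map (WithLp.toLp 2)

instance (m : ℕ) : (euclideanHaar m).IsAddHaarMeasure :=
  (PiLp.continuousLinearEquiv 2 ℝ (fun _ : Fin m => ℂ)).symm.isAddHaarMeasure_map
    (Measure.pi fun _ => volume)

theorem gaussianVector_eq_withDensity (m : ℕ) :
    gaussianVector m = (euclideanHaar m).withDensity
      fun x => ENNReal.ofReal ((Real.pi⁻¹) ^ m * Real.exp (-‖x‖ ^ 2)) := by
  have hm : Measurable (WithLp.toLp 2 : (Fin m → ℂ) → EuclideanSpace ℂ (Fin m)) := by fun_prop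
  have hsf : SigmaFinite ((volume : Measure ℂ).withDensity
      fun z : ℂ => ENNReal.ofReal (Real.pi⁻¹ * Real.exp (-‖z‖ ^ 2))) := by
    rw [← stdComplexGaussian_eq_withDensity]; infer_instance
  rw [gaussianVector, stdComplexGaussian_eq_withDensity, pi_withDensity _ _ _ (by fun_prop),
    euclideanHaar]
  ext s hs
  rw [Measure.map_apply hm hs, withDensity_apply _ (hm hs), withDensity_apply _ hs,
    setLIntegral_map hs (by fun_prop) hm]
  refine lintegral_congr fun p => ?_
  rw [← ENNReal.ofReal_prod_of_nonneg (fun i _ => by positivity), Finset.prod_mul_distrib,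
    ← Real.exp_sum, EuclideanSpace.norm_sq_eq]
  simp

/-- Unitary invariance of the standard complex Gaussian vector. -/
theorem map_gaussianVector (m : ℕ)
    (U : EuclideanSpace ℂ (Fin m) ≃ₗᵢ[ℂ] EuclideanSpace ℂ (Fin m)) :
    (gaussianVector m).map U = gaussianVector m := by
  let Ur : EuclideanSpace ℂ (Fin m) ≃L[ℝ] EuclideanSpace ℂ (Fin m) :=
    U.toContinuousLinearEquiv.restrictScalars ℝ
  have hUm : Measurable U := U.continuous.measurable
  have hdet : LinearMap.det (Ur.toLinearEquiv : EuclideanSpace ℂ (Fin m) →ₗ[ℝ] _) ≠ 0 :=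
    (LinearEquiv.isUnit_det' Ur.toLinearEquiv).ne_zero
  have hmap := Measure.map_linearMap_addHaar_eq_smul_addHaar (euclideanHaar m) hdet
  set c := ENNReal.ofReal |(LinearMap.det
    (Ur.toLinearEquiv : EuclideanSpace ℂ (Fin m) →ₗ[ℝ] _))⁻¹| with hc
  replace hmap : (euclideanHaar m).map U = c • euclideanHaar m := hmap
  have key : (gaussianVector m).map U = c • gaussianVector m := by
    rw [gaussianVector_eq_withDensity, ← withDensity_smul_measure, ← hmap]
    ext s hs
    rw [Measure.map_apply hUm hs, withDensity_apply _ (hUm hs), withDensity_apply _ hs,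
      setLIntegral_map hs (by fun_prop) hUm]
    simp only [LinearIsometryEquiv.norm_map]
  -- the Jacobian `c` is `1`, as both sides are probability measures
  have h1 : c = 1 := by
    have : IsProbabilityMeasure ((gaussianVector m).map U) :=
      Measure.isProbabilityMeasure_map hUm.aemeasurable
    simpa using congrArg (fun μ => μ univ) key.symm
  rw [key, h1, one_smul]

/-- Polar coordinates for a radial function with values in `[0, ∞]`. -/
theorem lintegral_fun_norm_addHaar {E : Type*} [NormedAddCommGroup E] [NormedSpace ℝ E]
    [Nontrivial E] [FiniteDimensional ℝ E] [MeasurableSpace E] [BorelSpace E]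
    (μ : Measure E) [μ.IsAddHaarMeasure] (f : ℝ → ℝ≥0∞) (hf : Measurable f) :
    ∫⁻ x, f ‖x‖ ∂μ = μ.toSphere univ *
      ∫⁻ y in Ioi (0 : ℝ), ENNReal.ofReal (y ^ (Module.finrank ℝ E - 1)) * f y := by
  calc
    ∫⁻ x, f ‖x‖ ∂μ = ∫⁻ x : ({(0)}ᶜ : Set E), f ‖x.1‖ ∂(μ.comap (↑)) := by
      rw [lintegral_subtype_comap (measurableSet_singleton _).compl fun x => f ‖x‖,
        restrict_compl_singleton]
    _ = ∫⁻ x : Metric.sphere (0 : E) 1 × Ioi (0 : ℝ), f x.2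
        ∂(μ.toSphere.prod (Measure.volumeIoiPow (Module.finrank ℝ E - 1))) := by
      rw [← (μ.measurePreserving_homeomorphUnitSphereProd).lintegral_comp (by fun_prop)]
      simp
    _ = _ := by
      have := lintegral_prod_mul (μ := μ.toSphere)
        (ν := Measure.volumeIoiPow (Module.finrank ℝ E - 1)) (f := fun _ => (1 : ℝ≥0∞))
        (g := fun y : Ioi (0 : ℝ) => f y) (by fun_prop) (by fun_prop)
      simp only [one_mul, lintegral_const] at this
      rw [this, Measure.volumeIoiPow,
        lintegral_withDensity_eq_lintegral_mul _ (by fun_prop) (by fun_prop)]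
      congr 1
      exact lintegral_subtype_comap measurableSet_Ioi
        fun y => ENNReal.ofReal (y ^ (Module.finrank ℝ E - 1)) * f y

theorem lintegral_gammaMeasure (m : ℕ) (f : ℝ → ℝ≥0∞) (hf : Measurable f) :
    ∫⁻ x, f x ∂(gammaMeasure m 1) = ∫⁻ x in Ioi (0 : ℝ),
      ENNReal.ofReal (Real.exp (-x) * x ^ ((m : ℝ) - 1) / Real.Gamma m) * f x := by
  have hg : Measurable (gammaPDF m 1) := (measurable_gammaPDFReal _ _).ennreal_ofReal
  rw [gammaMeasure, lintegral_withDensity_eq_lintegral_mul _ hg hf,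
    ← setLIntegral_eq_of_support_subset (s := Ici (0 : ℝ)), setLIntegral_congr Ioi_ae_eq_Ici.symm]
  · refine setLIntegral_congr_fun measurableSet_Ioi fun x (hx : 0 < x) => ?_
    simp only [Pi.mul_apply]
    rw [gammaPDF_of_nonneg hx.le, Real.one_rpow, one_mul]
    congr 2
    ring
  · intro x hx
    by_contra h
    simp [gammaPDF_of_neg (not_le.1 h)] at hx

/-- The squared norm of a standard Gaussian vector in `ℂ^m` has the Gamma law of shape `m`. -/
theorem map_norm_sq_gaussianVector {m : ℕ} (hm : 1 ≤ m) :
    (gaussianVector m).map (fun x => ‖x‖ ^ 2) = gammaMeasure m 1 := by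
  have hm0 : (0 : ℝ) < m := by exact_mod_cast hm
  have : Nonempty (Fin m) := ⟨⟨0, hm⟩⟩
  have hprob : IsProbabilityMeasure (gammaMeasure m 1) :=
    isProbabilityMeasure_gammaMeasure hm0 one_pos
  have hprob' : IsProbabilityMeasure ((gaussianVector m).map (fun x => ‖x‖ ^ 2)) :=
    Measure.isProbabilityMeasure_map (by fun_prop)
  have hdim : Module.finrank ℝ (EuclideanSpace ℂ (Fin m)) = 2 * m := by
    rw [← Module.finrank_mul_finrank ℝ ℂ]; simp [mul_comm]
  set Γ := Real.Gamma m with hΓ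
  have hΓ0 : 0 < Γ := Real.Gamma_pos_of_pos hm0
  set C : ℝ≥0∞ := (euclideanHaar m).toSphere univ * ENNReal.ofReal ((Real.pi⁻¹) ^ m * Γ / 2)
  -- the normalization `C` is not computed: it is `1` as both sides are probability measures
  have key : (gaussianVector m).map (fun x => ‖x‖ ^ 2) = C • gammaMeasure m 1 := by
    refine Measure.ext_of_lintegral _ fun f hf => ?_
    rw [lintegral_map hf (by fun_prop), gaussianVector_eq_withDensity,
      lintegral_withDensity_eq_lintegral_mul _ (by fun_prop) (by fun_prop)]
    have h1 := lintegral_fun_norm_addHaar (euclideanHaar m)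
      (fun r => ENNReal.ofReal ((Real.pi⁻¹) ^ m * Real.exp (-r ^ 2)) * f (r ^ 2)) (by fun_prop)
    simp only [Pi.mul_apply]
    rw [h1, hdim, lintegral_smul_measure, smul_eq_mul, mul_assoc]
    congr 1
    rw [lintegral_gammaMeasure m f hf, ← lintegral_const_mul _ (by fun_prop)]
    have himg : (fun r : ℝ => r ^ 2) '' Ioi 0 = Ioi 0 := by
      ext y
      simp only [mem_image, mem_Ioi]
      exact ⟨by rintro ⟨r, hr, rfl⟩; positivity,
        fun hy => ⟨√y, Real.sqrt_pos.2 hy, Real.sq_sqrt hy.le⟩⟩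
    -- the substitution `x = r²`
    conv_rhs => rw [← himg]
    rw [lintegral_image_eq_lintegral_abs_deriv_mul (f' := fun r => 2 * r) measurableSet_Ioi
      (fun r _ => by simpa using (hasDerivAt_pow 2 r).hasDerivWithinAt)
      (fun a ha b hb hab => (pow_left_inj₀ (le_of_lt ha) (le_of_lt hb) two_ne_zero).1 hab)]
    refine setLIntegral_congr_fun measurableSet_Ioi fun r (hr : 0 < r) => ?_
    rw [abs_of_pos (by positivity), ← mul_assoc, ← mul_assoc,
      ← mul_assoc, ← ENNReal.ofReal_mul (by positivity), ← ENNReal.ofReal_mul (by positivity),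
      ← ENNReal.ofReal_mul (by positivity)]
    congr 2
    have h3 : (r ^ 2) ^ ((m : ℝ) - 1) = r ^ (2 * m - 2) := by
      have : (m : ℝ) - 1 = ((m - 1 : ℕ) : ℝ) := by push_cast [hm]; ring
      rw [this, Real.rpow_natCast, ← pow_mul]
      congr 1
      omega
    have h4 : r ^ (2 * m - 1) = r ^ (2 * m - 2) * r := by
      rw [← pow_succ]; congr 1; omega
    rw [h3, h4, ← hΓ]
    field_simp
  have h1 : C = 1 := by simpa using congrArg (fun μ => μ univ) key.symm
  rw [key, h1, one_smul]

/-! ### Order statistics of i.i.d. samples -/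

theorem lt_descOrderStat_iff {K : ℕ} (v : Fin K → ℝ) (r : Fin K) (a : ℝ) :
    a < descOrderStat v r ↔ (r : ℕ) < (Finset.univ.filter fun l => a < v l).card := by
  have hanti : Antitone fun l => v (Tuple.sort v (Fin.rev l)) := fun i j hij =>
    Tuple.monotone_sort v (Fin.rev_le_rev.2 hij)
  rw [descOrderStat, ← Tuple.lt_card_gt_iff_apply_gt_of_antitone (j := r) hanti]
  congr! 1
  refine Finset.card_bij (fun l _ => Tuple.sort v (Fin.rev l)) (by simp) (fun a _ b _ h => ?_)
    fun b hb => ⟨Fin.rev ((Tuple.sort v).symm b), by simpa using hb, by simp⟩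
  exact Fin.rev_injective ((Tuple.sort v).injective h)

theorem exists_descOrderStat_eq {K : ℕ} (v : Fin K → ℝ) (r : Fin K) :
    ∃ k, descOrderStat v r = v k := ⟨_, rfl⟩

/-- Without ties, the value of rank `r` is the one exceeded by exactly `r` others. -/
theorem descOrderStat_eq_iff {K : ℕ} {v : Fin K → ℝ} (hv : Function.Injective v) (r k : Fin K) :
    descOrderStat v r = v k ↔ (Finset.univ.filter fun l => v k < v l).card = r := by
  have hlt : ∀ a, a < descOrderStat v r ↔ _ := lt_descOrderStat_iff v r
  constructor
  · intro h
    refine le_antisymm ?_ ?_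
    · have := (hlt (v k)).not.1 (by rw [h]; exact lt_irrefl _)
      omega
    · obtain hne | hne := (Finset.univ.filter fun l => v l < v k).eq_empty_or_nonempty
      · have h1 : (Finset.univ.filter fun l => v k < v l) = Finset.univ.erase k := by
          ext l
          have := Finset.filter_eq_empty_iff.1 hne (Finset.mem_univ l)
          simp only [Finset.mem_filter, Finset.mem_univ, true_and, Finset.mem_erase, and_true]
          exact ⟨fun h e => by simp [e] at h,
            fun h => lt_of_le_of_ne (not_lt.1 this) fun e => h (hv e).symm⟩
        rw [h1, Finset.card_erase_of_mem (Finset.mem_univ _), Finset.card_univ, Fintype.card_fin]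
        omega
      -- the largest value below `v k`
      · obtain ⟨l, hl, hmax⟩ := Finset.exists_max_image _ v hne
        simp only [Finset.mem_filter, Finset.mem_univ, true_and] at hl hmax
        have h1 := (hlt (v l)).1 (by rw [h]; exact hl)
        have h2 : (Finset.univ.filter fun j => v l < v j) =
            insert k (Finset.univ.filter fun j => v k < v j) := by
          ext j
          simp only [Finset.mem_filter, Finset.mem_univ, true_and, Finset.mem_insert]
          refine ⟨fun h => ?_, ?_⟩
          · rcases lt_trichotomy (v k) (v j) with h' | h' | h'
            · exact Or.inr h'
            · exact Or.inl (hv h').symm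
            · exact absurd (hmax j h') (not_le.2 h)
          · rintro (rfl | h)
            exacts [hl, hl.trans h]
        rw [h2, Finset.card_insert_of_notMem (by simp)] at h1
        omega
  · intro h
    obtain ⟨j, hj⟩ := exists_descOrderStat_eq v r
    rw [hj]
    have h1 : ¬ v k < v j := fun hlt' => by
      have := (hlt (v k)).1 (by rw [hj]; exact hlt'); omega
    have h2 : ¬ v j < v k := fun hlt' => by
      have h3 := (hlt (v j)).not.1 (by rw [hj]; exact lt_irrefl _)
      have : (Finset.univ.filter fun l => v k < v l) ⊂ Finset.univ.filter fun l => v j < v l := by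
        refine Finset.ssubset_iff_subset_ne.2 ⟨fun l => ?_, fun e => ?_⟩
        · simpa using fun h => hlt'.trans h
        · have := Finset.ext_iff.1 e k
          simp [hlt'] at this
      have := Finset.card_lt_card this
      omega
    exact le_antisymm (not_lt.1 h1) (not_lt.1 h2)

/-- The number of sample points above a level is binomial: sum over the set `S` of the indices of
these points. -/
theorem pi_card_lt_eq (ν : Measure ℝ) [IsProbabilityMeasure ν] (n r : ℕ) (x : ℝ) :
    Measure.pi (fun _ : Fin n => ν) {w | (Finset.univ.filter fun l => x < w l).card = r} =
      n.choose r * (ν (Ioi x) ^ r * ν (Iic x) ^ (n - r)) := by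
  have hset : {w : Fin n → ℝ | (Finset.univ.filter fun l => x < w l).card = r} =
      ⋃ S ∈ Finset.powersetCard r (Finset.univ : Finset (Fin n)),
        univ.pi fun l => if l ∈ S then Ioi x else Iic x := by
    ext w
    simp only [mem_ofPred_eq, mem_iUnion, mem_pi, mem_univ, true_imp_iff, Finset.mem_powersetCard,
      Finset.subset_univ, true_and, exists_prop]
    constructor
    · intro h
      refine ⟨_, h, fun l => ?_⟩
      by_cases hl : x < w l
      · simp [hl]
      · simp only [Finset.mem_filter, Finset.mem_univ, true_and, hl, if_false]
        exact not_lt.1 hl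
    · rintro ⟨S, hS, h⟩
      rw [← hS]
      congr 1
      ext l
      have := h l
      by_cases hl : l ∈ S
      · simpa [hl] using this
      · simpa [hl] using this
  have hdisj : (↑(Finset.powersetCard r (Finset.univ : Finset (Fin n))) :
      Set (Finset (Fin n))).PairwiseDisjoint fun S : Finset (Fin n) =>
        univ.pi fun l => if l ∈ S then Ioi x else Iic x := by
    intro S _ T _ hST
    refine disjoint_left.2 fun w hS hT => hST ?_
    ext l
    have h1 := hS l trivial
    have h2 := hT l trivial
    by_cases hl : l ∈ S <;> by_cases hl' : l ∈ T <;> simp [hl, hl'] at h1 h2 ⊢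
    · exact absurd h1 (not_lt.2 h2)
    · exact absurd h2 (not_lt.2 h1)
  rw [hset, measure_biUnion_finset hdisj fun S _ => MeasurableSet.univ_pi fun l => by
    split_ifs; exacts [measurableSet_Ioi, measurableSet_Iic]]
  rw [Finset.sum_congr rfl (g := fun _ => ν (Ioi x) ^ r * ν (Iic x) ^ (n - r))]
  · simp [Finset.sum_const, Finset.card_powersetCard]
  · intro S hS
    rw [Measure.pi_pi]
    simp only [apply_ite ν]
    rw [Finset.prod_ite, Finset.prod_const, Finset.prod_const]
    have h1 : (Finset.univ.filter fun l => l ∈ S).card = r := by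
      simpa using (Finset.mem_powersetCard.1 hS).2
    have h2 : (Finset.univ.filter fun l => l ∉ S).card = n - r := by
      have := Finset.card_filter_add_card_filter_not (s := (Finset.univ : Finset (Fin n)))
        (fun l => l ∈ S)
      simp only [Finset.card_univ, Fintype.card_fin] at this
      omega
    rw [h1, h2]

theorem ae_injective_pi (ν : Measure ℝ) [IsProbabilityMeasure ν] [NullSingletonClass ν] (n : ℕ) :
    ∀ᵐ v ∂(Measure.pi fun _ : Fin n => ν), Function.Injective v := by
  have : ∀ k l : Fin n, k ≠ l → ∀ᵐ v ∂(Measure.pi fun _ : Fin n => ν), v k ≠ v l := by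
    intro k l hkl
    obtain ⟨n, rfl⟩ : ∃ m, n = m + 1 := ⟨n - 1, by have := k.pos; omega⟩
    obtain ⟨j, rfl⟩ := Fin.exists_succAbove_eq hkl.symm
    have hmp := measurePreserving_piFinSuccAbove (fun _ : Fin (n + 1) => ν) k
    have h2 : ∀ᵐ p ∂(ν.prod (Measure.pi fun _ : Fin n => ν)), p.1 ≠ p.2 j := by
      have hms : MeasurableSet {p : ℝ × (Fin n → ℝ) | p.1 ≠ p.2 j} :=
        (measurableSet_eq_fun (by fun_prop) (by fun_prop)).compl
      have hmp2 := Measure.measurePreserving_swap (μ := Measure.pi fun _ : Fin n => ν) (ν := ν)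
      rw [← hmp2.map_eq, ae_map_iff (by fun_prop) hms,
        Measure.ae_prod_iff_ae_ae (p := fun z : (Fin n → ℝ) × ℝ => z.swap.1 ≠ z.swap.2 j)
          (measurable_swap hms)]
      refine .of_forall fun w => ?_
      simp [ae_iff]
    have := hmp.quasiMeasurePreserving.ae h2
    simpa [MeasurableEquiv.piFinSuccAbove, Fin.insertNthEquiv, Fin.removeNth] using this
  have h := ae_all_iff.2 fun k => ae_all_iff.2 fun l =>
    (show ∀ᵐ v ∂(Measure.pi fun _ : Fin n => ν), k ≠ l → v k ≠ v l by
      by_cases hkl : k = l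
      · simp [hkl]
      · simpa [hkl] using this k l hkl)
  filter_upwards [h] with v hv k l hkl
  by_contra hne
  exact hv k l hne hkl

theorem measurable_card_lt {n : ℕ} {α : Type*} [MeasurableSpace α] (f : α → ℝ) (g : α → Fin n → ℝ)
    (hf : Measurable f) (hg : Measurable g) :
    Measurable fun a => (Finset.univ.filter fun l => f a < g a l).card := by
  simp only [Finset.card_filter]
  refine Finset.measurable_fun_sum _ fun l _ => Measurable.ite ?_ measurable_const measurable_const
  exact measurableSet_lt hf (by fun_prop)

/-- The order statistics are determined by the numbers of values above each level, so no
measurability of the sorting permutation is needed. -/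
theorem measurable_descOrderStat {K : ℕ} (r : Fin K) :
    Measurable fun v : Fin K → ℝ => descOrderStat v r := by
  refine measurable_of_Ioi fun a => ?_
  have : (fun v : Fin K → ℝ => descOrderStat v r) ⁻¹' Ioi a =
      (fun v : Fin K → ℝ => (Finset.univ.filter fun l => a < v l).card) ⁻¹' Ioi (r : ℕ) := by
    ext v
    exact lt_descOrderStat_iff v r a
  rw [this]
  exact measurable_card_lt _ _ measurable_const measurable_id measurableSet_Ioi

/-- The law of an order statistic of an i.i.d. sample of size `n + 1` with continuous
distribution. -/
theorem lintegral_descOrderStat (ν : Measure ℝ) [IsProbabilityMeasure ν] [NullSingletonClass ν]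
    (n : ℕ) (r : Fin (n + 1)) (f : ℝ → ℝ≥0∞) (hf : Measurable f) :
    ∫⁻ v, f (descOrderStat v r) ∂(Measure.pi fun _ => ν) =
      (n + 1) * ∫⁻ x, f x * (n.choose r * (ν (Ioi x) ^ (r : ℕ) * ν (Iic x) ^ (n - r))) ∂ν := by
  have hsum : ∀ᵐ v ∂(Measure.pi fun _ : Fin (n + 1) => ν), f (descOrderStat v r) =
      ∑ k, f (v k) * {v : Fin (n + 1) → ℝ |
        (Finset.univ.filter fun l => v k < v l).card = (r : ℕ)}.indicator 1 v := by
    filter_upwards [ae_injective_pi ν (n + 1)] with v hv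
    obtain ⟨k, hk⟩ := exists_descOrderStat_eq v r
    rw [Finset.sum_eq_single k]
    · rw [indicator_of_mem (mem_ofPred_eq ▸ (descOrderStat_eq_iff hv r k).1 hk :
        v ∈ {v : Fin (n + 1) → ℝ | _}), hk]
      simp
    · intro l _ hl
      rw [indicator_of_notMem, mul_zero]
      intro h
      exact hl (hv (((descOrderStat_eq_iff hv r l).2 h).symm.trans hk))
    · simp
  have hms : ∀ k : Fin (n + 1), MeasurableSet {v : Fin (n + 1) → ℝ |
      (Finset.univ.filter fun l => v k < v l).card = (r : ℕ)} := fun k =>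
    measurable_card_lt (fun v : Fin (n + 1) → ℝ => v k) id (by fun_prop) measurable_id
      (measurableSet_singleton (r : ℕ))
  rw [lintegral_congr_ae hsum, lintegral_finsetSum _ fun k _ => by
    exact (hf.comp (measurable_pi_apply k)).mul (measurable_one.indicator (hms k))]
  -- by Fubini, given that the value at the index `k` is `x`, the number of others above it is
  -- binomial
  have hterm : ∀ k : Fin (n + 1), ∫⁻ v, f (v k) * {v : Fin (n + 1) → ℝ |
        (Finset.univ.filter fun l => v k < v l).card = (r : ℕ)}.indicator 1 v
        ∂(Measure.pi fun _ : Fin (n + 1) => ν) =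
      ∫⁻ x, f x * (n.choose r * (ν (Ioi x) ^ (r : ℕ) * ν (Iic x) ^ (n - r))) ∂ν := by
    intro k
    have hmp := measurePreserving_piFinSuccAbove (fun _ : Fin (n + 1) => ν) k
    let F : ℝ × (Fin n → ℝ) → ℝ≥0∞ := fun p => f p.1 * {p : ℝ × (Fin n → ℝ) |
        (Finset.univ.filter fun l => p.1 < p.2 l).card = (r : ℕ)}.indicator 1 p
    have hmsF : MeasurableSet {p : ℝ × (Fin n → ℝ) |
        (Finset.univ.filter fun l => p.1 < p.2 l).card = (r : ℕ)} :=
      measurable_card_lt (fun p : ℝ × (Fin n → ℝ) => p.1) (fun p => p.2) measurable_fst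
        measurable_snd (measurableSet_singleton (r : ℕ))
    have hF : Measurable F := (hf.comp measurable_fst).mul (measurable_one.indicator hmsF)
    trans ∫⁻ p, F p ∂(ν.prod (Measure.pi fun _ : Fin n => ν))
    · rw [← hmp.lintegral_comp hF]
      refine lintegral_congr fun v => ?_
      have hcard : (Finset.univ.filter fun l : Fin n => v k < v (k.succAbove l)).card =
          (Finset.univ.filter fun l => v k < v l).card := by
        rw [Finset.card_filter, Finset.card_filter, Fin.sum_univ_succAbove _ k]
        simp
      have hiff : (k.insertNthEquiv (fun _ => ℝ)).symm v ∈ {p : ℝ × (Fin n → ℝ) |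
          (Finset.univ.filter fun l => p.1 < p.2 l).card = (r : ℕ)} ↔
          v ∈ {v : Fin (n + 1) → ℝ | (Finset.univ.filter fun l => v k < v l).card = (r : ℕ)} :=
        iff_of_eq (congrArg (· = (r : ℕ)) hcard)
      change _ = f (v k) * indicator _ 1 ((k.insertNthEquiv (fun _ => ℝ)).symm v)
      congr 1
      by_cases h : v ∈ {v : Fin (n + 1) → ℝ |
          (Finset.univ.filter fun l => v k < v l).card = (r : ℕ)}
      · rw [indicator_of_mem h, indicator_of_mem (hiff.2 h)]
        rfl
      · rw [indicator_of_notMem h, indicator_of_notMem (mt hiff.1 h)]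
    · rw [lintegral_prod _ hF.aemeasurable]
      refine lintegral_congr fun x => ?_
      rw [← pi_card_lt_eq]
      simp only [F]
      have hms' : MeasurableSet {w : Fin n → ℝ |
          (Finset.univ.filter fun l => x < w l).card = (r : ℕ)} :=
        measurable_card_lt (fun _ => x) id (by fun_prop) measurable_id
          (measurableSet_singleton (r : ℕ))
      rw [← lintegral_indicator_one hms',
        ← lintegral_const_mul _ (measurable_one.indicator hms')]
      rfl
  simp only [hterm, Finset.sum_const, Finset.card_univ, Fintype.card_fin, nsmul_eq_mul]
  push_cast
  rfl

/-! ### Order statistics of Gamma variables -/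

theorem isProbabilityMeasure_gammaMeasure_natCast {m : ℕ} (hm : 1 ≤ m) :
    IsProbabilityMeasure (gammaMeasure m 1) :=
  isProbabilityMeasure_gammaMeasure (by exact_mod_cast hm) one_pos

instance (m : ℕ) : NullSingletonClass (gammaMeasure m 1) := by
  rw [gammaMeasure]; infer_instance

theorem gammaMeasure_Iic_eq_setLIntegral (m : ℕ) (x : ℝ) :
    gammaMeasure m 1 (Iic x) =
      ∫⁻ t in Ioc 0 x, ENNReal.ofReal (Real.exp (-t) * t ^ ((m : ℝ) - 1) / Real.Gamma m) := by
  rw [← lintegral_indicator_one measurableSet_Iic,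
    lintegral_gammaMeasure _ _ (measurable_one.indicator measurableSet_Iic), ← Ioi_inter_Iic,
    inter_comm, ← setLIntegral_indicator measurableSet_Iic]
  refine lintegral_congr fun t => ?_
  by_cases ht : t ∈ Iic x <;> simp [ht]

theorem gamma_natCast_pos {m : ℕ} (hm : 1 ≤ m) : 0 < Real.Gamma m :=
  Real.Gamma_pos_of_pos (by exact_mod_cast hm)

theorem regGamma_eq {m : ℕ} (hm : 1 ≤ m) {x : ℝ} (hx : 0 ≤ x) :
    regGamma m x = (gammaMeasure m 1).real (Iic x) := by
  have hm0 : (0 : ℝ) < m := by exact_mod_cast hm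
  have hΓ := gamma_natCast_pos hm
  rw [Measure.real, gammaMeasure_Iic_eq_setLIntegral, ← integral_eq_lintegral_of_nonneg_ae,
    regGamma, intervalIntegral.integral_of_le hx, ← integral_const_mul]
  · refine integral_congr_ae (.of_forall fun t => ?_)
    simp only
    ring
  · exact (ae_restrict_iff' measurableSet_Ioc).2 (.of_forall fun t ht => by
      have := ht.1
      simp only [Pi.zero_apply]
      positivity)
  · exact Measurable.aestronglyMeasurable (by fun_prop)

theorem regGamma_mem_Icc {m : ℕ} (hm : 1 ≤ m) {x : ℝ} (hx : 0 ≤ x) :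
    regGamma m x ∈ Icc (0 : ℝ) 1 := by
  have := isProbabilityMeasure_gammaMeasure_natCast hm
  rw [regGamma_eq hm hx]
  exact ⟨measureReal_nonneg, measureReal_le_one⟩

theorem regGamma_one_le {x : ℝ} (hx : 0 ≤ x) : regGamma 1 x ≤ x := by
  rw [regGamma_eq le_rfl hx, Measure.real, gammaMeasure_Iic_eq_setLIntegral]
  refine ENNReal.toReal_le_of_le_ofReal hx ?_
  calc _ ≤ ∫⁻ _ in Ioc 0 x, (1 : ℝ≥0∞) := by
        refine setLIntegral_mono measurable_const fun t ht => ?_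
        simpa using ht.1.le
    _ = _ := by simp

theorem integrableOn_alphaIntegrand {m k : ℕ} (hm : 1 ≤ m) (hk : 1 ≤ k) (h : 2 ≤ m ∨ 2 ≤ k) :
    IntegrableOn (alphaIntegrand m k) (Ioi 0) := by
  have hΓ := gamma_natCast_pos hm
  have := isProbabilityMeasure_gammaMeasure_natCast hm
  have hmeas : AEStronglyMeasurable (alphaIntegrand m k) (volume.restrict (Ioi 0)) := by
    have hmono : Monotone fun x : ℝ => (gammaMeasure m 1).real (Iic x) := fun x y hxy =>
      measureReal_mono (Iic_subset_Iic.2 hxy)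
    have h1 := hmono.measurable
    have : Measurable fun x : ℝ => k * (Real.exp (-x) * x ^ ((m : ℝ) - 2) / Real.Gamma m) *
        ((gammaMeasure m 1).real (Iic x)) ^ (k - 1) := by fun_prop
    refine this.aestronglyMeasurable.congr ?_
    filter_upwards [ae_restrict_mem measurableSet_Ioi] with x hx
    rw [alphaIntegrand, regGamma_eq hm (le_of_lt hx)]
  have hexp : IntegrableOn (fun x : ℝ => Real.exp (-x) * x ^ ((1 : ℝ) - 1)) (Ioi 0) :=
    Real.GammaIntegral_convergent one_pos
  by_cases hm2 : 2 ≤ m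
  · have hint : IntegrableOn (fun x : ℝ => Real.exp (-x) * x ^ (((m : ℝ) - 1) - 1)) (Ioi 0) :=
      Real.GammaIntegral_convergent (by
        have : (2 : ℝ) ≤ m := by exact_mod_cast hm2
        linarith)
    refine Integrable.mono' (hint.const_mul (k / Real.Gamma m)) hmeas ?_
    filter_upwards [ae_restrict_mem measurableSet_Ioi] with x (hx : 0 < x)
    obtain ⟨h0, h1⟩ := regGamma_mem_Icc hm hx.le
    rw [alphaIntegrand, Real.norm_of_nonneg (by positivity),
      show (m : ℝ) - 1 - 1 = m - 2 by ring]
    calc _ ≤ k * (Real.exp (-x) * x ^ ((m : ℝ) - 2) / Real.Gamma m) * 1 := by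
          gcongr
          exact pow_le_one₀ h0 h1
      _ = _ := by ring
  -- for `m = 1` the factor `x⁻¹` is compensated by `G(1, x) ≤ x`
  · obtain rfl : m = 1 := by omega
    obtain ⟨q, rfl⟩ : ∃ q, k = q + 2 := ⟨k - 2, by omega⟩
    refine Integrable.mono' (hexp.const_mul ((q + 2 : ℕ) : ℝ)) hmeas ?_
    filter_upwards [ae_restrict_mem measurableSet_Ioi] with x (hx : 0 < x)
    obtain ⟨h0, h1⟩ := regGamma_mem_Icc hm hx.le
    rw [alphaIntegrand, Real.norm_of_nonneg (by positivity)]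
    have h2 : regGamma 1 x ^ (q + 2 - 1) ≤ x := by
      rw [show q + 2 - 1 = q + 1 by omega, pow_succ]
      calc _ ≤ 1 * x := by
            gcongr
            · exact pow_le_one₀ h0 h1
            · exact regGamma_one_le hx.le
        _ = x := one_mul x
    have h3 : x ^ (((1 : ℕ) : ℝ) - 2) = x⁻¹ := by
      rw [show (((1 : ℕ) : ℝ) - 2) = -1 by norm_num, Real.rpow_neg_one]
    rw [h3, sub_self, Real.rpow_zero]
    calc _ ≤ ((q + 2 : ℕ) : ℝ) * (Real.exp (-x) * x⁻¹ / Real.Gamma (1 : ℕ)) * x := by gcongr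
      _ = _ := by
        simp only [Nat.cast_one, Real.Gamma_one, div_one, mul_one]
        field_simp

theorem map_normSq_gaussianVectors {K m : ℕ} (hm : 1 ≤ m) :
    (gaussianVectors K m).map
      (fun g k => ‖(WithLp.toLp 2 (g k) : EuclideanSpace ℂ (Fin m))‖ ^ 2) =
      Measure.pi fun _ => gammaMeasure m 1 := by
  have := isProbabilityMeasure_gammaMeasure_natCast hm
  have h1 : (Measure.pi fun _ : Fin m => stdComplexGaussian).map
      (fun x => ‖(WithLp.toLp 2 x : EuclideanSpace ℂ (Fin m))‖ ^ 2) = gammaMeasure m 1 := by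
    rw [← map_norm_sq_gaussianVector hm, gaussianVector, Measure.map_map (by fun_prop)
      (by fun_prop)]
    rfl
  have : SigmaFinite ((Measure.pi fun _ : Fin m => stdComplexGaussian).map
      (fun x => ‖(WithLp.toLp 2 x : EuclideanSpace ℂ (Fin m))‖ ^ 2)) := by
    rw [h1]; infer_instance
  have h2 := Measure.pi_map_pi (ι := Fin K)
    (μ := fun _ => Measure.pi fun _ : Fin m => stdComplexGaussian)
    (f := fun _ x => ‖(WithLp.toLp 2 x : EuclideanSpace ℂ (Fin m))‖ ^ 2) (fun _ => by fun_prop)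
  rw [h1] at h2
  exact h2

theorem descOrderStat_nonneg {K : ℕ} {v : Fin K → ℝ} (hv : ∀ k, 0 ≤ v k) (r : Fin K) :
    0 ≤ descOrderStat v r := hv _

theorem measurable_normSqOrderStat {K m : ℕ} (r : Fin K) :
    Measurable (normSqOrderStat (m := m) r) :=
  (measurable_descOrderStat r).comp (by fun_prop)

/-- Mean of the inverse of an order statistic, in terms of the density
`(n+1) C(n,r) f (1-F)^r F^(n-r)` of that order statistic. The inverse is taken in `[0, ∞]`. -/
theorem lintegral_inv_normSqOrderStat {m n : ℕ} (hm : 1 ≤ m) (r : Fin (n + 1)) :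
    ∫⁻ g, (ENNReal.ofReal (normSqOrderStat r g))⁻¹ ∂(gaussianVectors (n + 1) m) =
      ∫⁻ x in Ioi (0 : ℝ), ENNReal.ofReal ((n + 1) * n.choose r *
        (Real.exp (-x) * x ^ ((m : ℝ) - 2) / Real.Gamma m) *
          ((1 - regGamma m x) ^ (r : ℕ) * regGamma m x ^ (n - r))) := by
  have hprob := isProbabilityMeasure_gammaMeasure_natCast hm
  have hΓ := gamma_natCast_pos hm
  have hmono : Monotone fun x : ℝ => gammaMeasure m 1 (Iic x) := fun x y hxy =>
    measure_mono (Iic_subset_Iic.2 hxy)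
  have hanti : Antitone fun x : ℝ => gammaMeasure m 1 (Ioi x) := fun x y hxy =>
    measure_mono (Ioi_subset_Ioi hxy)
  have hm1 := hmono.measurable
  have hm2 := hanti.measurable
  calc _ = ∫⁻ v, (ENNReal.ofReal (descOrderStat v r))⁻¹
        ∂(Measure.pi fun _ : Fin (n + 1) => gammaMeasure m 1) := by
        have := measurable_descOrderStat r
        rw [← map_normSq_gaussianVectors hm, lintegral_map (by fun_prop) (by fun_prop)]
        rfl
    _ = (n + 1) * ∫⁻ x, (ENNReal.ofReal x)⁻¹ * (n.choose r *
          (gammaMeasure m 1 (Ioi x) ^ (r : ℕ) * gammaMeasure m 1 (Iic x) ^ (n - r)))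
          ∂(gammaMeasure m 1) :=
        lintegral_descOrderStat _ n r (fun x => (ENNReal.ofReal x)⁻¹) (by fun_prop)
    _ = _ := by
        rw [lintegral_gammaMeasure m _ (by fun_prop), ← lintegral_const_mul _ (by fun_prop)]
        refine setLIntegral_congr_fun measurableSet_Ioi fun x (hx : 0 < x) => ?_
        obtain ⟨h0, h1⟩ := regGamma_mem_Icc hm hx.le
        have hIic : gammaMeasure m 1 (Iic x) = ENNReal.ofReal (regGamma m x) := by
          rw [regGamma_eq hm hx.le, ofReal_measureReal]
        have hIoi : gammaMeasure m 1 (Ioi x) = ENNReal.ofReal (1 - regGamma m x) := by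
          rw [← compl_Iic, prob_compl_eq_one_sub measurableSet_Iic, hIic,
            ENNReal.ofReal_sub _ h0, ENNReal.ofReal_one]
        have hn : ((n : ℝ≥0∞) + 1) = ENNReal.ofReal (n + 1) := by
          rw [ENNReal.ofReal_add (by positivity) zero_le_one, ENNReal.ofReal_natCast,
            ENNReal.ofReal_one]
        have h1' : 0 ≤ 1 - regGamma m x := by linarith
        rw [hIic, hIoi, hn, ← ENNReal.ofReal_inv_of_pos hx, ← ENNReal.ofReal_natCast,
          ← ENNReal.ofReal_pow h1', ← ENNReal.ofReal_pow h0, ← ENNReal.ofReal_mul (by positivity),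
          ← ENNReal.ofReal_mul (by positivity), ← ENNReal.ofReal_mul (by positivity),
          ← ENNReal.ofReal_mul (by positivity), ← ENNReal.ofReal_mul (by positivity)]
        congr 1
        have h3 : x ^ ((m : ℝ) - 1) = x ^ ((m : ℝ) - 2) * x := by
          rw [← Real.rpow_add_one hx.ne']
          congr 1
          ring
        rw [h3]
        field_simp

/-- If the density of the order statistic divided by the variable is an integrable function `φ`,
then the inverse of the order statistic is integrable, with mean the integral of `φ`. -/
theorem integral_inv_normSqOrderStat {m n : ℕ} (hm : 1 ≤ m) (r : Fin (n + 1)) {φ : ℝ → ℝ}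
    (hφ : IntegrableOn φ (Ioi 0))
    (hφr : ∀ x, 0 < x → φ x = (n + 1) * n.choose r *
        (Real.exp (-x) * x ^ ((m : ℝ) - 2) / Real.Gamma m) *
          ((1 - regGamma m x) ^ (r : ℕ) * regGamma m x ^ (n - r))) :
    ∫⁻ g, (ENNReal.ofReal (normSqOrderStat r g))⁻¹ ∂(gaussianVectors (n + 1) m) =
        ENNReal.ofReal (∫ x in Ioi (0 : ℝ), φ x) ∧
      Integrable (fun g => (normSqOrderStat r g)⁻¹) (gaussianVectors (n + 1) m) ∧
      ∫ g, (normSqOrderStat r g)⁻¹ ∂(gaussianVectors (n + 1) m) = ∫ x in Ioi (0 : ℝ), φ x := by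
  have hΓ := gamma_natCast_pos hm
  have hφ0 : 0 ≤ᵐ[volume.restrict (Ioi 0)] φ := by
    filter_upwards [ae_restrict_mem measurableSet_Ioi] with x (hx : 0 < x)
    obtain ⟨h0, h1⟩ := regGamma_mem_Icc hm hx.le
    have h1' : 0 ≤ 1 - regGamma m x := by linarith
    rw [hφr x hx, Pi.zero_apply]
    positivity
  have hl : ∫⁻ g, (ENNReal.ofReal (normSqOrderStat r g))⁻¹ ∂(gaussianVectors (n + 1) m) =
        ENNReal.ofReal (∫ x in Ioi (0 : ℝ), φ x) := by
    rw [ofReal_integral_eq_lintegral_ofReal hφ hφ0, lintegral_inv_normSqOrderStat hm r]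
    exact setLIntegral_congr_fun measurableSet_Ioi fun x hx => by simp only [hφr x hx]
  have hmeas : Measurable fun g : Fin (n + 1) → Fin m → ℂ =>
      (ENNReal.ofReal (normSqOrderStat r g))⁻¹ :=
    (measurable_normSqOrderStat r).ennreal_ofReal.inv
  have hre : ∀ g : Fin (n + 1) → Fin m → ℂ, (normSqOrderStat r g)⁻¹ =
      ((ENNReal.ofReal (normSqOrderStat r g))⁻¹).toReal := fun g => by
    have h0 : 0 ≤ normSqOrderStat r g := descOrderStat_nonneg (fun k => by positivity) r
    rw [ENNReal.toReal_inv, ENNReal.toReal_ofReal h0]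
  have hfin : ∫⁻ g, (ENNReal.ofReal (normSqOrderStat r g))⁻¹ ∂(gaussianVectors (n + 1) m) ≠ ∞ := by
    rw [hl]; exact ENNReal.ofReal_ne_top
  refine ⟨hl, ?_, ?_⟩
  · simp only [hre]
    exact integrable_toReal_of_lintegral_ne_top hmeas.aemeasurable hfin
  · simp only [hre]
    rw [integral_toReal hmeas.aemeasurable (ae_lt_top hmeas hfin), hl,
      ENNReal.toReal_ofReal (integral_nonneg_of_ae hφ0)]

/-! ### The explicit formula -/

/-- The value of `E[1 / X]` for `X` the `(r + 1)`-st largest of `K` independent Gamma variables of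
shape `m`, for `r ≤ 3`, as a combination of the constants `α_{m,k}`. -/
def meanInvOrderStat (m K : ℕ) : Fin 4 → ℝ :=
  ![alpha m K,
    K * alpha m (K - 1) - (K - 1) * alpha m K,
    K * (K - 1) / 2 * alpha m (K - 2) - K * (K - 2) * alpha m (K - 1)
      + (K - 1) * (K - 2) / 2 * alpha m K,
    K * (K - 1) * (K - 2) / 6 * alpha m (K - 3) - K * (K - 1) * (K - 3) / 2 * alpha m (K - 2)
      + K * (K - 2) * (K - 3) / 2 * alpha m (K - 1)
      - (K - 1) * (K - 2) * (K - 3) / 6 * alpha m K]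

theorem cast_choose_three (n : ℕ) :
    ((n + 2).choose 3 : ℝ) = (n + 2) * (n + 1) * n / 6 := by
  have h := Nat.add_one_mul_choose_eq (n + 1) 2
  have h' : ((n + 1 + 1 : ℕ) : ℝ) * ((n + 1).choose 2 : ℕ) = ((n + 2).choose 3 : ℕ) * 3 := by
    exact_mod_cast h
  rw [Nat.cast_choose_two] at h'
  push_cast at h'
  linarith

/-- If the polynomial `K C(K-1,r) (1-G)^r G^(K-1-r)`, with `K = q + 5`, is expanded along the
polynomials `k G^(k-1)`, then `E[1 / X]` has the same expansion along the constants `α_{m,k}`. -/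
theorem integral_inv_normSqOrderStat_of_expansion {m q : ℕ} (hm : 1 ≤ m) (r : Fin (q + 5))
    (a b c d : ℝ)
    (h : ∀ G : ℝ, a * ((q + 5) * G ^ (q + 4)) + b * ((q + 4) * G ^ (q + 3)) +
      c * ((q + 3) * G ^ (q + 2)) + d * ((q + 2) * G ^ (q + 1)) =
        (q + 5) * (q + 4).choose r * ((1 - G) ^ (r : ℕ) * G ^ (q + 4 - r))) {v : ℝ}
    (hv : v = a * alpha m (q + 5) + b * alpha m (q + 4) + c * alpha m (q + 3) +
      d * alpha m (q + 2)) :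
    ∫⁻ g, (ENNReal.ofReal (normSqOrderStat r g))⁻¹ ∂(gaussianVectors (q + 5) m) =
        ENNReal.ofReal v ∧
      Integrable (fun g => (normSqOrderStat r g)⁻¹) (gaussianVectors (q + 5) m) ∧
      ∫ g, (normSqOrderStat r g)⁻¹ ∂(gaussianVectors (q + 5) m) = v := by
  have hI : ∀ k, IntegrableOn (alphaIntegrand m (k + 2)) (Ioi 0) := fun k =>
    integrableOn_alphaIntegrand hm (by omega) (Or.inr (by omega))
  have ha : IntegrableOn (fun x => a * alphaIntegrand m (q + 5) x) (Ioi 0) :=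
    (hI (q + 3)).const_mul a
  have hb : IntegrableOn (fun x => b * alphaIntegrand m (q + 4) x) (Ioi 0) :=
    (hI (q + 2)).const_mul b
  have hc : IntegrableOn (fun x => c * alphaIntegrand m (q + 3) x) (Ioi 0) :=
    (hI (q + 1)).const_mul c
  have hd : IntegrableOn (fun x => d * alphaIntegrand m (q + 2) x) (Ioi 0) := (hI q).const_mul d
  have hab : IntegrableOn (fun x => a * alphaIntegrand m (q + 5) x + b * alphaIntegrand m (q + 4) x)
    (Ioi 0) := ha.add hb
  have habc : IntegrableOn (fun x => a * alphaIntegrand m (q + 5) x +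
    b * alphaIntegrand m (q + 4) x + c * alphaIntegrand m (q + 3) x) (Ioi 0) := hab.add hc
  have hint : ∫ x in Ioi (0 : ℝ), (a * alphaIntegrand m (q + 5) x + b * alphaIntegrand m (q + 4) x +
      c * alphaIntegrand m (q + 3) x + d * alphaIntegrand m (q + 2) x) = v := by
    rw [integral_add habc hd, integral_add hab hc, integral_add ha hb,
      integral_const_mul, integral_const_mul, integral_const_mul, integral_const_mul, hv]
    rfl
  rw [← hint]
  refine integral_inv_normSqOrderStat (n := q + 4) hm r (habc.add hd) fun x _ => ?_
  have := h (regGamma m x)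
  simp only [alphaIntegrand, show q + 5 - 1 = q + 4 from rfl,
    show q + 4 - 1 = q + 3 from rfl, show q + 3 - 1 = q + 2 from rfl,
    show q + 2 - 1 = q + 1 from rfl]
  push_cast
  linear_combination (Real.exp (-x) * x ^ ((m : ℝ) - 2) / Real.Gamma m) * this

theorem meanInvOrderStat_spec {m K : ℕ} (hm : 1 ≤ m) (hK : 4 < K) (i : Fin 4) :
    ∫⁻ g, (ENNReal.ofReal (normSqOrderStat (Fin.castLE hK.le i) g))⁻¹ ∂(gaussianVectors K m) =
        ENNReal.ofReal (meanInvOrderStat m K i) ∧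
      Integrable (fun g => (normSqOrderStat (Fin.castLE hK.le i) g)⁻¹) (gaussianVectors K m) ∧
      ∫ g, (normSqOrderStat (Fin.castLE hK.le i) g)⁻¹ ∂(gaussianVectors K m) =
        meanInvOrderStat m K i := by
  obtain ⟨q, rfl⟩ : ∃ q, K = q + 5 := ⟨K - 5, by omega⟩
  have hc2 : ((q + 4).choose 2 : ℝ) = (q + 4) * (q + 3) / 2 := by
    rw [Nat.cast_choose_two]; push_cast; ring
  have hc3 : ((q + 4).choose 3 : ℝ) = (q + 4) * (q + 3) * (q + 2) / 6 := by
    have := cast_choose_three (q + 2)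
    push_cast at this
    rw [this]; ring
  have e1 : q + 5 - 1 = q + 4 := rfl
  have e2 : q + 5 - 2 = q + 3 := rfl
  have e3 : q + 5 - 3 = q + 2 := rfl
  fin_cases i
  · refine integral_inv_normSqOrderStat_of_expansion hm _ 1 0 0 0 (fun G => ?_) ?_
    · simp
    · simp [meanInvOrderStat]
  · refine integral_inv_normSqOrderStat_of_expansion hm _ (-(q + 4)) (q + 5) 0 0 (fun G => ?_) ?_
    · simp
      ring
    · simp only [meanInvOrderStat, e1]
      simp
      ring
  · refine integral_inv_normSqOrderStat_of_expansion hm _ ((q + 4) * (q + 3) / 2)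
      (-((q + 5) * (q + 3))) ((q + 5) * (q + 4) / 2) 0 (fun G => ?_) ?_
    · simp [hc2, show q + 4 - 2 = q + 2 from rfl]
      ring
    · simp only [meanInvOrderStat, e1, e2]
      simp
      ring
  · refine integral_inv_normSqOrderStat_of_expansion hm _ (-((q + 4) * (q + 3) * (q + 2) / 6))
      ((q + 5) * (q + 3) * (q + 2) / 2) (-((q + 5) * (q + 4) * (q + 2) / 2))
      ((q + 5) * (q + 4) * (q + 3) / 6) (fun G => ?_) ?_
    · simp [hc3, show q + 4 - 3 = q + 1 from rfl]
      ring
    · simp only [meanInvOrderStat, e1, e2, e3]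
      simp
      ring

theorem susFourFormula_eq_sum (M K : ℕ) (σ γ : ℝ) :
    susFourFormula M K σ γ = σ ^ 2 * γ * ∑ i : Fin 4, meanInvOrderStat (M - i) K i := by
  simp only [susFourFormula, Fin.sum_univ_four, meanInvOrderStat]
  simp
  ring

/-! ### Triangularization by Householder reflections -/

/-- The subspace of `ℂ^M` of the vectors supported on the coordinates before `j`. -/
def headSpace (M j : ℕ) : Submodule ℂ (EuclideanSpace ℂ (Fin M)) where
  carrier := {x | ∀ m : Fin M, j ≤ m → x m = 0}
  add_mem' hx hy m hm := by simp [hx m hm, hy m hm]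
  zero_mem' m _ := rfl
  smul_mem' c x hx m hm := by simp [hx m hm]

theorem mem_headSpace {M j : ℕ} {x : EuclideanSpace ℂ (Fin M)} :
    x ∈ headSpace M j ↔ ∀ m : Fin M, j ≤ m → x m = 0 := Iff.rfl

theorem headSpace_mono {M : ℕ} : Monotone (headSpace M) := fun _ _ hij _ hx m hm =>
  hx m (hij.trans hm)

theorem headSpace_zero (M : ℕ) : headSpace M 0 = ⊥ := by
  refine eq_bot_iff.2 fun x hx => ?_
  ext m
  exact hx m (Nat.zero_le _)

/-- The linear map that replaces the coordinates before `j` by zero. -/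
def tail (M j : ℕ) : EuclideanSpace ℂ (Fin M) →ₗ[ℂ] EuclideanSpace ℂ (Fin M) where
  toFun x := WithLp.toLp 2 fun m => if j ≤ m then x m else 0
  map_add' x y := by ext m; by_cases h : j ≤ m <;> simp [h]
  map_smul' c x := by ext m; by_cases h : j ≤ m <;> simp [h]

theorem tail_apply {M : ℕ} (j : ℕ) (x : EuclideanSpace ℂ (Fin M)) (m : Fin M) :
    tail M j x m = if j ≤ m then x m else 0 := rfl

theorem sub_tail_mem_headSpace {M : ℕ} (j : ℕ) (x : EuclideanSpace ℂ (Fin M)) :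
    x - tail M j x ∈ headSpace M j := fun m hm => by simp [tail_apply, hm]

theorem tail_eq_zero {M j : ℕ} {x : EuclideanSpace ℂ (Fin M)} (hx : x ∈ headSpace M j) :
    tail M j x = 0 := by
  ext m
  by_cases h : j ≤ m
  · simp [tail_apply, h, hx m h]
  · simp [tail_apply, h]

theorem tail_eq_self {M j : ℕ} {x : EuclideanSpace ℂ (Fin M)} (hx : ∀ m : Fin M, m < j → x m = 0) :
    tail M j x = x := by
  ext m
  by_cases h : j ≤ m
  · simp [tail_apply, h]
  · simp [tail_apply, h, hx m (not_le.1 h)]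

theorem inner_eq_zero_of_mem_headSpace {M j : ℕ} {x w : EuclideanSpace ℂ (Fin M)}
    (hx : x ∈ headSpace M j) (hw : ∀ m : Fin M, m < j → w m = 0) : ⟪w, x⟫_ℂ = 0 := by
  rw [PiLp.inner_apply]
  refine Finset.sum_eq_zero fun m _ => ?_
  by_cases h : j ≤ m
  · simp [hx m h]
  · simp [hw m (not_le.1 h)]

theorem projEnergy_headSpace {M : ℕ} (j : ℕ) (x : EuclideanSpace ℂ (Fin M)) :
    projEnergy (headSpace M j) x = ‖tail M j x‖ ^ 2 := by
  rw [projEnergy]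
  congr 2
  have htail : ∀ m : Fin M, m < j → tail M j x m = 0 := fun m hm => by
    simp [tail_apply, not_le.2 hm]
  refine Submodule.eq_starProjection_of_mem_of_inner_eq_zero ?_ fun w hw => ?_
  · exact (Submodule.mem_orthogonal' _ _).2 fun u hu => inner_eq_zero_of_mem_headSpace hu htail
  · exact (Submodule.mem_orthogonal _ _).1 hw _ (sub_tail_mem_headSpace j x)

theorem projEnergy_map {M : ℕ} (V : EuclideanSpace ℂ (Fin M) ≃ₗᵢ[ℂ] EuclideanSpace ℂ (Fin M))
    (W : Submodule ℂ (EuclideanSpace ℂ (Fin M))) (x : EuclideanSpace ℂ (Fin M)) :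
    projEnergy (W.map V.toLinearEquiv.toLinearMap) (V x) = projEnergy W x := by
  have h := Submodule.starProjection_map_apply V Wᗮ (V x)
  simp only [Submodule.map_orthogonal_equiv, LinearIsometryEquiv.symm_apply_apply] at h
  rw [projEnergy, projEnergy, h, LinearIsometryEquiv.norm_map]

/-- The Householder vector: the sum of the tail of `v` (the coordinates from `j` on) and the
multiple of the `j`-th basis vector that has the same norm and the phase of the `j`-th coordinate
of `v`. The phase of `0` is `0` here. -/
def householderVec {M : ℕ} (j : ℕ) (v : EuclideanSpace ℂ (Fin M)) : EuclideanSpace ℂ (Fin M) :=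
  tail M j v + WithLp.toLp 2 fun m : Fin M =>
    if (m : ℕ) = j then v m / (‖v m‖ : ℂ) * (‖tail M j v‖ : ℂ) else 0

/-- The reflection in the line of the Householder vector. It fixes that line and is `-1` on its
orthogonal complement. -/
def householder {M : ℕ} (j : ℕ) (v : EuclideanSpace ℂ (Fin M)) :
    EuclideanSpace ℂ (Fin M) ≃ₗᵢ[ℂ] EuclideanSpace ℂ (Fin M) :=
  (ℂ ∙ householderVec j v).reflection

theorem householderVec_apply_of_lt {M j : ℕ} (v : EuclideanSpace ℂ (Fin M)) (m : Fin M)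
    (hm : (m : ℕ) < j) : householderVec j v m = 0 := by
  simp [householderVec, tail_apply, not_le.2 hm, hm.ne]

theorem householder_apply {M : ℕ} (j : ℕ) (v x : EuclideanSpace ℂ (Fin M)) :
    householder j v x = 2 • (⟪householderVec j v, x⟫_ℂ / (‖householderVec j v‖ : ℂ) ^ 2) •
      householderVec j v - x :=
  Submodule.reflection_singleton_apply _ _

theorem householder_of_mem_headSpace {M j : ℕ} (v : EuclideanSpace ℂ (Fin M))
    {x : EuclideanSpace ℂ (Fin M)} (hx : x ∈ headSpace M j) : householder j v x = -x := by
  rw [householder_apply, inner_eq_zero_of_mem_headSpace hx (householderVec_apply_of_lt v)]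
  simp

theorem tail_householder {M i j : ℕ} (hij : i ≤ j) (v x : EuclideanSpace ℂ (Fin M)) :
    tail M i (householder j v x) = householder j v (tail M i x) := by
  have h1 : householder j v x =
      householder j v (x - tail M i x) + householder j v (tail M i x) := by
    rw [← map_add, sub_add_cancel]
  have hmem := sub_tail_mem_headSpace i x
  rw [h1, householder_of_mem_headSpace v (headSpace_mono hij hmem), map_add, map_neg,
    tail_eq_zero hmem, neg_zero, zero_add]
  refine tail_eq_self fun m hm => ?_
  rw [householder_apply]
  simp [householderVec_apply_of_lt v m (hm.trans_le hij), tail_apply, not_le.2 hm]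

theorem norm_tail_householder {M i j : ℕ} (hij : i ≤ j) (v x : EuclideanSpace ℂ (Fin M)) :
    ‖tail M i (householder j v x)‖ = ‖tail M i x‖ := by
  rw [tail_householder hij, LinearIsometryEquiv.norm_map]

/-- The Householder reflection takes `u` to the multiple of the unit vector `e` that has the norm of
`u` and the phase of `⟪e, u⟫`. With this choice of the phase both vectors have the same inner
product with their sum. -/
theorem reflection_householder {E : Type*} [NormedAddCommGroup E] [InnerProductSpace ℂ E]
    (u e : E) (he : ⟪e, e⟫_ℂ = 1) (z : ℂ) (hz : ⟪e, u⟫_ℂ = z) (hz0 : z ≠ 0) :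
    (ℂ ∙ (u + (z / (‖z‖ : ℂ) * (‖u‖ : ℂ)) • e)).reflection u =
      (z / (‖z‖ : ℂ) * (‖u‖ : ℂ)) • e := by
  set N := ‖u‖ with hN
  have hz0' : (‖z‖ : ℂ) ≠ 0 := by simpa using hz0
  have hu0 : u ≠ 0 := fun h => hz0 (by rw [← hz, h, inner_zero_right])
  have hN0 : 0 < N := norm_pos_iff.2 hu0
  set p : ℂ := z / ‖z‖ with hp
  set w := u + (p * N) • e with hw
  have hzz : (starRingEnd ℂ) z * z = (‖z‖ : ℂ) ^ 2 := by
    rw [mul_comm, Complex.mul_conj, Complex.normSq_eq_norm_sq]; push_cast; rfl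
  have hpz : (starRingEnd ℂ) p * z = ‖z‖ := by
    rw [hp, map_div₀, Complex.conj_ofReal, div_mul_eq_mul_div, hzz]
    field_simp
  have hzp : (starRingEnd ℂ) z * p = ‖z‖ := by
    rw [hp, ← mul_div_assoc, hzz]
    field_simp
  have hpp : (starRingEnd ℂ) p * p = 1 := by
    have : (starRingEnd ℂ) p * p = (starRingEnd ℂ) p * z / ‖z‖ := by rw [hp, mul_div_assoc]
    rw [this, hpz]
    exact div_self hz0'
  have hue : ⟪u, e⟫_ℂ = (starRingEnd ℂ) z := by rw [← hz, inner_conj_symm]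
  have huu : ⟪u, u⟫_ℂ = (N : ℂ) ^ 2 := inner_self_eq_norm_sq_to_K (𝕜 := ℂ) u
  have h1 : ⟪w, u⟫_ℂ = N ^ 2 + N * ‖z‖ := by
    rw [hw, inner_add_left, inner_smul_left, huu, hz, map_mul, Complex.conj_ofReal]
    linear_combination (N : ℂ) * hpz
  have h2 : (‖w‖ : ℂ) ^ 2 = 2 * (N ^ 2 + N * ‖z‖) := by
    have : (‖w‖ : ℂ) ^ 2 = ⟪w, w⟫_ℂ := (inner_self_eq_norm_sq_to_K (𝕜 := ℂ) w).symm
    rw [this, hw, inner_add_left, inner_add_right, inner_add_right, inner_smul_left,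
      inner_smul_right, inner_smul_left, inner_smul_right, huu, hz, hue, he, map_mul,
      Complex.conj_ofReal]
    linear_combination (N : ℂ) * hpz + (N : ℂ) * hzp + (N : ℂ) ^ 2 * hpp
  have h3 : (N : ℂ) ^ 2 + N * ‖z‖ ≠ 0 := by
    have : (0 : ℝ) < N ^ 2 + N * ‖z‖ := by positivity
    exact_mod_cast this.ne'
  have h4 : ((N : ℂ) ^ 2 + N * ‖z‖) / (2 * (N ^ 2 + N * ‖z‖)) = 1 / 2 := by
    rw [mul_comm 2, ← div_div, div_self h3]
  have h5 : (ℂ ∙ w).reflection u = 2 • (⟪w, u⟫_ℂ / (‖w‖ : ℂ) ^ 2) • w - u :=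
    Submodule.reflection_singleton_apply w u
  rw [h5, h1, h2, h4, two_nsmul, ← add_smul, add_halves, one_smul, hw, add_sub_cancel_left]

/-- The reflection of the tail of `v` is a multiple of a basis vector. -/
theorem householder_tail {M j : ℕ} (hj : j < M) (v : EuclideanSpace ℂ (Fin M))
    (hv : v ⟨j, hj⟩ ≠ 0) :
    ∃ c : ℂ, c ≠ 0 ∧
      householder j v (tail M j v) = c • EuclideanSpace.single (⟨j, hj⟩ : Fin M) (1 : ℂ) := by
  have htj : tail M j v ⟨j, hj⟩ = v ⟨j, hj⟩ := by simp [tail_apply]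
  have hN0 : ‖tail M j v‖ ≠ 0 := fun h => hv (by rw [← htj, norm_eq_zero.1 h]; rfl)
  have hw : householderVec j v = tail M j v +
      (v ⟨j, hj⟩ / (‖v ⟨j, hj⟩‖ : ℂ) * (‖tail M j v‖ : ℂ)) •
        EuclideanSpace.single (⟨j, hj⟩ : Fin M) (1 : ℂ) := by
    rw [householderVec]
    congr 1
    ext m
    by_cases h : (m : ℕ) = j
    · obtain rfl : m = ⟨j, hj⟩ := Fin.ext h
      simp
    · have h' : m ≠ ⟨j, hj⟩ := fun e => h (congrArg Fin.val e)
      simp [h, h']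
  refine ⟨v ⟨j, hj⟩ / (‖v ⟨j, hj⟩‖ : ℂ) * (‖tail M j v‖ : ℂ),
    mul_ne_zero (div_ne_zero hv (by simpa using hv)) (by simpa using hN0), ?_⟩
  have := reflection_householder (tail M j v) (EuclideanSpace.single (⟨j, hj⟩ : Fin M) (1 : ℂ))
    (by rw [EuclideanSpace.inner_single_left]; simp) (v ⟨j, hj⟩)
    (by rw [EuclideanSpace.inner_single_left, htj]; simp) hv
  rw [← hw] at this
  exact this

/-- The reflection takes the span of the first `j` basis vectors and the pivot to the span of the
first `j + 1` basis vectors. -/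
theorem map_householder_headSpace_sup {M j : ℕ} (hj : j < M) (v : EuclideanSpace ℂ (Fin M))
    (hv : v ⟨j, hj⟩ ≠ 0) :
    (headSpace M j ⊔ ℂ ∙ v).map (householder j v).toLinearEquiv.toLinearMap =
      headSpace M (j + 1) := by
  obtain ⟨c, hc, hcv⟩ := householder_tail hj v hv
  have hhead : ∀ x ∈ headSpace M j, householder j v x ∈ headSpace M j := fun x hx => by
    rw [householder_of_mem_headSpace v hx]; exact neg_mem hx
  have hsingle : EuclideanSpace.single (⟨j, hj⟩ : Fin M) (1 : ℂ) ∈ headSpace M (j + 1) := by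
    refine mem_headSpace.2 fun m hm => ?_
    have : m ≠ ⟨j, hj⟩ := fun e => by simp [e] at hm
    simp [this]
  refine le_antisymm (Submodule.map_le_iff_le_comap.2 (sup_le (fun x hx => ?_) ?_)) fun x hx => ?_
  · exact headSpace_mono (Nat.le_succ j) (hhead x hx)
  · rw [Submodule.span_singleton_le_iff_mem]
    change householder j v v ∈ headSpace M (j + 1)
    have : householder j v v = householder j v (v - tail M j v) + householder j v (tail M j v) := by
      rw [← map_add, sub_add_cancel]
    rw [this, hcv]
    exact (headSpace M (j + 1)).add_mem
      (headSpace_mono (Nat.le_succ j) (hhead _ (sub_tail_mem_headSpace j v)))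
      (Submodule.smul_mem _ _ hsingle)
  · have hx1 : x = (x - tail M j x) +
        x ⟨j, hj⟩ • EuclideanSpace.single (⟨j, hj⟩ : Fin M) (1 : ℂ) := by
      ext m
      rcases lt_trichotomy (m : ℕ) j with h | h | h
      · have h' : m ≠ ⟨j, hj⟩ := fun e => by simp [e] at h
        simp [tail_apply, not_le.2 h, h']
      · obtain rfl : m = ⟨j, hj⟩ := Fin.ext h
        simp [tail_apply]
      · have h' : m ≠ ⟨j, hj⟩ := fun e => by simp [e] at h
        simp [tail_apply, h.le, h', hx m h]
    have hmem : ∀ y ∈ headSpace M j,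
        y ∈ (headSpace M j ⊔ ℂ ∙ v).map (householder j v).toLinearEquiv.toLinearMap := by
      intro y hy
      refine ⟨-y, Submodule.mem_sup_left (neg_mem hy), ?_⟩
      change householder j v (-y) = y
      rw [householder_of_mem_headSpace v (neg_mem hy), neg_neg]
    rw [hx1]
    refine add_mem (hmem _ (sub_tail_mem_headSpace j x)) (Submodule.smul_mem _ _ ?_)
    have htail : tail M j v ∈ headSpace M j ⊔ ℂ ∙ v := by
      rw [show tail M j v = v - (v - tail M j v) by abel]
      exact sub_mem (Submodule.mem_sup_right (Submodule.mem_span_singleton_self v))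
        (Submodule.mem_sup_left (sub_tail_mem_headSpace j v))
    refine ⟨c⁻¹ • tail M j v, Submodule.smul_mem _ _ htail, ?_⟩
    change householder j v (c⁻¹ • tail M j v) = _
    rw [map_smul, hcv, smul_smul, inv_mul_cancel₀ hc, one_smul]

/-- One triangularization step: all vectors but the pivot `a` are reflected by the Householder
reflection of the pivot. -/
def rotStep {M K : ℕ} (j : ℕ) (a : Fin K) (H : Fin K → EuclideanSpace ℂ (Fin M)) :
    Fin K → EuclideanSpace ℂ (Fin M) :=
  fun k => if k = a then H k else householder j (H a) (H k)

/-- The first `j` triangularization steps with pivots `t 0, t 1, …`. -/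
def rotIter {M K : ℕ} (t : ℕ → Fin K) :
    ℕ → (Fin K → EuclideanSpace ℂ (Fin M)) → Fin K → EuclideanSpace ℂ (Fin M)
  | 0, H => H
  | j + 1, H => rotStep j (t j) (rotIter t j H)

/-- Step `j` and all later ones preserve the energy of the coordinates from `i ≤ j` on. -/
theorem norm_tail_rotIter {M K : ℕ} (t : ℕ → Fin K) (H : Fin K → EuclideanSpace ℂ (Fin M))
    (k : Fin K) {i j : ℕ} (hij : i ≤ j) :
    ‖tail M i (rotIter t j H k)‖ = ‖tail M i (rotIter t i H k)‖ := by
  induction j, hij using Nat.le_induction with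
  | base => rfl
  | succ j hij ih =>
    rw [← ih, rotIter, rotStep]
    split_ifs with h
    · rfl
    · exact norm_tail_householder hij _ _

/-- After `j` steps the vectors that were not pivots have all been moved by one unitary map, which
takes the span of the pivots to the span of the first `j` basis vectors. -/
theorem exists_unitary_rotIter {M K : ℕ} (t : ℕ → Fin K) (H : Fin K → EuclideanSpace ℂ (Fin M))
    (j : ℕ) (hj : j ≤ M) (ht : ∀ i < j, ∀ l < i, t l ≠ t i)
    (hne : ∀ i (hi : i < j), rotIter t i H (t i) ⟨i, hi.trans_le hj⟩ ≠ 0) :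
    ∃ V : EuclideanSpace ℂ (Fin M) ≃ₗᵢ[ℂ] EuclideanSpace ℂ (Fin M),
      (∀ k, (∀ l < j, t l ≠ k) → rotIter t j H k = V (H k)) ∧
      (Submodule.span ℂ ((fun l => H (t l)) '' Iio j)).map V.toLinearEquiv.toLinearMap =
        headSpace M j := by
  induction j with
  | zero =>
    refine ⟨LinearIsometryEquiv.refl ℂ _, fun k _ => rfl, ?_⟩
    rw [headSpace_zero]
    simp
  | succ j ih =>
    obtain ⟨V, hV, hspan⟩ := ih (Nat.le_of_succ_le hj)
      (fun i hi => ht i (hi.trans (Nat.lt_succ_self j)))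
      fun i hi => hne i (hi.trans (Nat.lt_succ_self j))
    refine ⟨V.trans (householder j (rotIter t j H (t j))), fun k hk => ?_, ?_⟩
    · rw [rotIter, rotStep, if_neg (hk j (Nat.lt_succ_self j)).symm,
        hV k fun l hl => hk l (hl.trans (Nat.lt_succ_self j))]
      rfl
    · have himg : (fun l => H (t l)) '' Iio (j + 1) =
          insert (H (t j)) ((fun l => H (t l)) '' Iio j) := by
        rw [← image_insert_eq (f := fun l => H (t l))]
        congr 1
        ext l
        simp only [mem_Iio, mem_insert_iff]
        omega
      have hlast := hne j (Nat.lt_succ_self j)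
      have hVj := hV (t j) (ht j (Nat.lt_succ_self j))
      rw [← map_householder_headSpace_sup _ _ hlast, himg, Submodule.span_insert, sup_comm, ← hspan]
      have h1 : (ℂ ∙ rotIter t j H (t j)) =
          (ℂ ∙ H (t j)).map V.toLinearEquiv.toLinearMap := by
        rw [Submodule.map_span, image_singleton, hVj]
        rfl
      conv_rhs => rw [h1, ← Submodule.map_sup, ← Submodule.map_comp]
      rfl

/-- The projected energies of the algorithm are tail energies of the triangularized vectors. -/
theorem projEnergy_span_eq {M K : ℕ} (t : ℕ → Fin K) (H : Fin K → EuclideanSpace ℂ (Fin M))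
    {j n : ℕ} (hj : j ≤ M) (hjn : j ≤ n) (ht : ∀ i < j, ∀ l < i, t l ≠ t i)
    (hne : ∀ i (hi : i < j), rotIter t i H (t i) ⟨i, hi.trans_le hj⟩ ≠ 0)
    (k : Fin K) (hk : ∀ l < j, t l ≠ k) :
    projEnergy (Submodule.span ℂ ((fun l => H (t l)) '' Iio j)) (H k) =
      ‖tail M j (rotIter t n H k)‖ ^ 2 := by
  obtain ⟨V, hV, hspan⟩ := exists_unitary_rotIter t H j hj ht hne
  rw [norm_tail_rotIter t H k hjn, hV k hk, ← projEnergy_headSpace, ← hspan, projEnergy_map]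

/-! ### The triangularization preserves the Gaussian law -/

/-- The law of `K` independent standard complex Gaussian vectors of the Euclidean space `ℂ^M`. -/
def gaussianEnsemble (K M : ℕ) : Measure (Fin K → EuclideanSpace ℂ (Fin M)) :=
  Measure.pi fun _ => gaussianVector M

instance (K M : ℕ) : IsProbabilityMeasure (gaussianEnsemble K M) := by
  rw [gaussianEnsemble]; infer_instance

theorem map_pi_comp_injective {ι κ α : Type*} [Fintype ι] [Fintype κ] [MeasurableSpace α]
    (μ : Measure α) [IsProbabilityMeasure μ] {e : κ → ι} (he : Function.Injective e) :
    (Measure.pi fun _ : ι => μ).map (fun x k => x (e k)) = Measure.pi fun _ : κ => μ := by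
  have h1 : iIndepFun (fun (i : ι) (x : ι → α) => x i) (Measure.pi fun _ : ι => μ) :=
    iIndepFun_pi (X := fun _ => id) fun _ => aemeasurable_id
  have h2 := (iIndepFun_iff_map_fun_eq_pi_map
    (fun k => (measurable_pi_apply (e k)).aemeasurable)).1 (h1.precomp he)
  rw [h2]
  congr 1
  ext1 k
  exact (measurePreserving_eval (fun _ : ι => μ) (e k)).map_eq

theorem measurable_tail {M : ℕ} (j : ℕ) : Measurable (tail M j) :=
  (tail M j).continuous_of_finiteDimensional.measurable

theorem measurable_householderVec {M : ℕ} (j : ℕ) :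
    Measurable (householderVec (M := M) j) := by
  have := measurable_tail (M := M) j
  refine this.add ((WithLp.measurable_toLp 2 _).comp (measurable_pi_lambda _ fun m => ?_))
  split_ifs
  · fun_prop
  · fun_prop

theorem measurable_householder {M : ℕ} (j : ℕ) :
    Measurable fun p : EuclideanSpace ℂ (Fin M) × EuclideanSpace ℂ (Fin M) =>
      householder j p.1 p.2 := by
  have := measurable_householderVec (M := M) j
  simp only [householder_apply]
  have h1 : Measurable fun p : EuclideanSpace ℂ (Fin M) × EuclideanSpace ℂ (Fin M) =>
      ⟪householderVec j p.1, p.2⟫_ℂ := (this.comp measurable_fst).inner measurable_snd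
  have h2 : Measurable fun p : EuclideanSpace ℂ (Fin M) × EuclideanSpace ℂ (Fin M) =>
      householderVec j p.1 := this.comp measurable_fst
  fun_prop

/-- Transforming all coordinates but `a` by a map that preserves `μ` and may depend on the
coordinate `a` preserves the product measure, as the coordinate `a` is independent of the others. -/
theorem measurePreserving_pivot {E : Type*} [MeasurableSpace E] (μ : Measure E)
    [IsProbabilityMeasure μ] {K : ℕ} (a : Fin K) (φ : E → E → E)
    (hφ : Measurable fun p : E × E => φ p.1 p.2) (hμ : ∀ v, μ.map (φ v) = μ) :
    MeasurePreserving (fun (H : Fin K → E) k => if k = a then H k else φ (H a) (H k))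
      (Measure.pi fun _ => μ) (Measure.pi fun _ => μ) := by
  obtain ⟨n, rfl⟩ : ∃ n, K = n + 1 := ⟨K - 1, by have := a.pos; omega⟩
  have hmp := measurePreserving_piFinSuccAbove (fun _ : Fin (n + 1) => μ) a
  have hmeas : Measurable (Function.uncurry fun (v : E) (x : Fin n → E) (l : Fin n) =>
      φ v (x l)) := by
    refine measurable_pi_lambda _ fun l => ?_
    have h1 : Measurable fun p : E × (Fin n → E) => (p.1, p.2 l) := by fun_prop
    exact hφ.comp h1
  have hmap : ∀ v : E, (Measure.pi fun _ : Fin n => μ).map (fun x l => φ v (x l)) =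
      Measure.pi fun _ => μ := fun v => by
    have hv : Measurable (φ v) := hφ.comp measurable_prodMk_left
    have h2 := Measure.pi_map_pi (ι := Fin n) (μ := fun _ => μ) (f := fun _ => φ v)
      (hμ := fun _ => by rw [hμ]; infer_instance) (fun _ => hv.aemeasurable)
    rw [hμ] at h2
    exact h2
  have hskew := MeasurePreserving.skew_product (MeasurePreserving.id μ) hmeas (.of_forall hmap)
  have := (hmp.symm.comp hskew).comp hmp
  convert! this using 1
  ext1 H
  refine (MeasurableEquiv.eq_symm_apply _).2 ?_
  refine Prod.ext ?_ (funext fun l => ?_)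
  · change (if a = a then H a else _) = H a
    simp
  · change (if a.succAbove l = a then _ else φ (H a) (H (a.succAbove l))) =
      φ (H a) (H (a.succAbove l))
    rw [if_neg (Fin.succAbove_ne a l)]

theorem measurePreserving_rotStep {M K : ℕ} (j : ℕ) (a : Fin K) :
    MeasurePreserving (rotStep (M := M) j a) (gaussianEnsemble K M) (gaussianEnsemble K M) :=
  measurePreserving_pivot (gaussianVector M) a (fun v => householder j v)
    (measurable_householder j) fun v => map_gaussianVector M (householder j v)

theorem measurePreserving_rotIter {M K : ℕ} (t : ℕ → Fin K) (j : ℕ) :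
    MeasurePreserving (rotIter (M := M) t j) (gaussianEnsemble K M) (gaussianEnsemble K M) := by
  induction j with
  | zero => exact MeasurePreserving.id _
  | succ j ih => exact (measurePreserving_rotStep j (t j)).comp ih

/-- The coordinates from `i` on of all vectors. -/
def dropCoords {K M : ℕ} (i : ℕ) (H : Fin K → EuclideanSpace ℂ (Fin M)) :
    Fin K → Fin (M - i) → ℂ :=
  fun k m => H k ⟨m + i, by omega⟩

theorem norm_dropCoords {K M : ℕ} (i : ℕ) (H : Fin K → EuclideanSpace ℂ (Fin M)) (k : Fin K) :
    ‖(WithLp.toLp 2 (dropCoords i H k) : EuclideanSpace ℂ (Fin (M - i)))‖ ^ 2 =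
      ‖tail M i (H k)‖ ^ 2 := by
  rw [EuclideanSpace.norm_sq_eq, EuclideanSpace.norm_sq_eq]
  refine Finset.sum_of_injOn (fun m => (⟨m + i, by omega⟩ : Fin M)) ?_ (by simp) ?_ ?_
  · intro a _ b _ hab
    simpa [Fin.ext_iff] using hab
  · intro m _ hm
    have : ¬ i ≤ m := fun h => hm ⟨⟨m - i, by omega⟩, by simp, by simp [h]⟩
    simp [tail_apply, this]
  · intro m _
    simp [tail_apply, dropCoords]

theorem measurePreserving_dropCoords (K M i : ℕ) :
    MeasurePreserving (dropCoords (K := K) (M := M) i) (gaussianEnsemble K M)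
      (gaussianVectors K (M - i)) := by
  have hinj : Function.Injective fun m : Fin (M - i) => (⟨m + i, by omega⟩ : Fin M) :=
    fun a b hab => by simpa [Fin.ext_iff] using hab
  have h1 : (gaussianVector M).map (fun x (m : Fin (M - i)) => x ⟨m + i, by omega⟩) =
      Measure.pi fun _ => stdComplexGaussian := by
    rw [gaussianVector, Measure.map_map (by fun_prop) (by fun_prop)]
    exact map_pi_comp_injective stdComplexGaussian hinj
  have h2 := Measure.pi_map_pi (ι := Fin K) (μ := fun _ => gaussianVector M)
    (f := fun _ x (m : Fin (M - i)) => x ⟨m + i, by omega⟩)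
    (hμ := fun _ => by rw [h1]; infer_instance) (fun _ => by fun_prop)
  rw [h1] at h2
  exact ⟨by unfold dropCoords; fun_prop, h2⟩

theorem ae_apply_ne_zero {K M : ℕ} (k : Fin K) (m : Fin M) :
    ∀ᵐ H ∂(gaussianEnsemble K M), H k m ≠ 0 := by
  have h1 : MeasurePreserving (fun x : Fin M → ℂ => x m)
      (Measure.pi fun _ => stdComplexGaussian) stdComplexGaussian :=
    measurePreserving_eval (fun _ : Fin M => stdComplexGaussian) m
  have h2 : ∀ᵐ x ∂(gaussianVector M), x m ≠ 0 := by
    have hms : MeasurableSet {x : EuclideanSpace ℂ (Fin M) | x m ≠ 0} :=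
      (measurableSet_eq_fun (by fun_prop) measurable_const).compl
    rw [gaussianVector, ae_map_iff (by fun_prop) hms]
    refine h1.quasiMeasurePreserving.ae (p := fun z => z ≠ 0) ?_
    simp [ae_iff]
  exact (measurePreserving_eval (fun _ : Fin K => gaussianVector M) k).quasiMeasurePreserving.ae h2

/-- Almost surely there are no ties between the energies of the tails. -/
theorem ae_injective_norm_tail {K M i : ℕ} (hi : i < M) :
    ∀ᵐ H ∂(gaussianEnsemble K M), Function.Injective fun k => ‖tail M i (H k)‖ ^ 2 := by
  have hprob := isProbabilityMeasure_gammaMeasure_natCast (m := M - i) (by omega)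
  have h := ae_injective_pi (gammaMeasure (M - i : ℕ) 1) K
  rw [← map_normSq_gaussianVectors (by omega)] at h
  have hmeas : Measurable fun (g : Fin K → Fin (M - i) → ℂ) k =>
    ‖(WithLp.toLp 2 (g k) : EuclideanSpace ℂ (Fin (M - i)))‖ ^ 2 := by fun_prop
  have h2 := ae_of_ae_map hmeas.aemeasurable h
  have h3 := (measurePreserving_dropCoords K M i).quasiMeasurePreserving.ae h2
  filter_upwards [h3] with H hH
  simpa only [norm_dropCoords] using hH

/-- The joint law of independent standard Gaussian channel coefficients. -/
theorem map_channels {Ω : Type*} [MeasurableSpace Ω] (P : Measure Ω) [IsProbabilityMeasure P]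
    {K M : ℕ} (h : Fin K → Fin M → Ω → ℂ)
    (hindep : iIndepFun (fun p : Fin K × Fin M => h p.1 p.2) P)
    (hlaw : ∀ k m, HasLaw (h k m) stdComplexGaussian P) :
    AEMeasurable (fun ω k => (WithLp.toLp 2 (fun m => h k m ω) : EuclideanSpace ℂ (Fin M))) P ∧
    P.map (fun ω k => (WithLp.toLp 2 (fun m => h k m ω) : EuclideanSpace ℂ (Fin M))) =
      gaussianEnsemble K M := by
  have hm : ∀ p : Fin K × Fin M, AEMeasurable (h p.1 p.2) P := fun p => (hlaw p.1 p.2).aemeasurable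
  have hm' : AEMeasurable (fun ω (p : Fin K × Fin M) => h p.1 p.2 ω) P :=
    aemeasurable_pi_lambda _ hm
  have h1 := (iIndepFun_iff_map_fun_eq_pi_map hm).1 hindep
  have h2 : (Measure.pi fun p : Fin K × Fin M => P.map (h p.1 p.2)) =
      Measure.pi fun _ => stdComplexGaussian := by
    congr 1
    ext1 p
    exact (hlaw p.1 p.2).map_eq
  rw [h2] at h1
  have h3 := Measure.infinitePi_map_curry (fun (_ : Fin K) (_ : Fin M) => stdComplexGaussian)
  simp only [Measure.infinitePi_eq_pi] at h3
  have h4 := Measure.pi_map_pi (ι := Fin K) (μ := fun _ => Measure.pi fun _ : Fin M =>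
    stdComplexGaussian) (f := fun _ => (WithLp.toLp 2 : (Fin M → ℂ) → EuclideanSpace ℂ (Fin M)))
    (hμ := fun _ => by
      change SigmaFinite (gaussianVector M)
      infer_instance) (fun _ => by fun_prop)
  refine ⟨aemeasurable_pi_lambda _ fun k => (WithLp.measurable_toLp 2 _).comp_aemeasurable
    (aemeasurable_pi_lambda _ fun m => hm (k, m)), ?_⟩
  have hmeas : Measurable fun (x : Fin K → Fin M → ℂ) k =>
    (WithLp.toLp 2 (x k) : EuclideanSpace ℂ (Fin M)) := by fun_prop
  rw [← h3, ← h1, AEMeasurable.map_map_of_aemeasurable (by fun_prop) hm',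
    AEMeasurable.map_map_of_aemeasurable hmeas.aemeasurable
      ((MeasurableEquiv.measurable _).comp_aemeasurable hm')] at h4
  exact h4

/-! ### Comparison of the greedy selection with the order statistics -/

/-- The list `t` of users is an outcome of the greedy selection in which the energies of the
projections are replaced by the energies of the tails of the vectors `G`. -/
def IsGreedy {M K n : ℕ} (G : Fin K → EuclideanSpace ℂ (Fin M)) (t : Fin n → Fin K) : Prop :=
  ∀ i : Fin n, (∀ j < i, t j ≠ t i) ∧
    ∀ k : Fin K, (∀ j < i, t j ≠ k) → ‖tail M i (G k)‖ ^ 2 ≤ ‖tail M i (G (t i))‖ ^ 2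

/-- In the absence of ties the greedy selection is determined by the energies. -/
theorem IsGreedy.unique {M K n : ℕ} {G : Fin K → EuclideanSpace ℂ (Fin M)} {t t' : Fin n → Fin K}
    (hG : ∀ i : Fin n, Function.Injective fun k => ‖tail M i (G k)‖ ^ 2)
    (ht : IsGreedy G t) (ht' : IsGreedy G t') : t = t' := by
  funext i
  induction i using WellFoundedLT.induction with
  | ind i ih =>
    have h1 : ∀ j < i, t j ≠ t' i := fun j hj => by rw [ih j hj]; exact (ht' i).1 j hj
    have h2 : ∀ j < i, t' j ≠ t i := fun j hj => by rw [← ih j hj]; exact (ht i).1 j hj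
    exact hG i (le_antisymm ((ht' i).2 _ h2) ((ht i).2 _ h1))

/-- The value selected in a round with `i` earlier selections is maximal outside a set of `i`
indices, so it is at least the `(i + 1)`-st largest. -/
theorem IsGreedy.descOrderStat_le {M K n : ℕ} {G : Fin K → EuclideanSpace ℂ (Fin M)}
    {t : Fin n → Fin K} (ht : IsGreedy G t) (hn : n ≤ K) (i : Fin n) :
    descOrderStat (fun k => ‖tail M i (G k)‖ ^ 2) (Fin.castLE hn i) ≤
      ‖tail M i (G (t i))‖ ^ 2 := by
  rw [← not_lt, lt_descOrderStat_iff, not_lt]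
  have hsub : (Finset.univ.filter fun l => ‖tail M i (G (t i))‖ ^ 2 < ‖tail M i (G l)‖ ^ 2) ⊆
      (Finset.Iio i).image t := by
    intro l hl
    simp only [Finset.mem_filter, Finset.mem_univ, true_and] at hl
    by_contra h
    refine absurd ((ht i).2 l fun j hj e => h ?_) (not_le.2 hl)
    exact Finset.mem_image.2 ⟨j, Finset.mem_Iio.2 hj, e⟩
  calc _ ≤ ((Finset.Iio i).image t).card := Finset.card_le_card hsub
    _ ≤ (Finset.Iio i).card := Finset.card_image_le
    _ = _ := by simp

theorem measurableSet_isGreedy {M K n : ℕ} (t : Fin n → Fin K) :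
    MeasurableSet {G : Fin K → EuclideanSpace ℂ (Fin M) | IsGreedy G t} := by
  have hm : ∀ (i : ℕ) (k : Fin K), Measurable fun G : Fin K → EuclideanSpace ℂ (Fin M) =>
      ‖tail M i (G k)‖ ^ 2 := fun i k =>
    ((measurable_tail i).comp (measurable_pi_apply k)).norm.pow_const 2
  refine measurableSet_setOfPred.2 (Measurable.forall fun i => measurable_const.and
    (Measurable.forall fun k => measurable_const.imp ?_))
  exact measurableSet_setOfPred.1 (measurableSet_le (hm _ _) (hm _ _))

/-- A tuple of users as an infinite (periodic) sequence of pivots. -/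
def pivots {K n : ℕ} (t : Fin (n + 1) → Fin K) (j : ℕ) : Fin K := t (Fin.ofNat (n + 1) j)

theorem pivots_val {K n : ℕ} (t : Fin (n + 1) → Fin K) (i : Fin (n + 1)) : pivots t i = t i := by
  rw [pivots, Fin.ofNat_val_eq_self]

/-- The triangularized channels, for the pivots `t`. -/
def triang {M K n : ℕ} (t : Fin (n + 1) → Fin K) (H : Fin K → EuclideanSpace ℂ (Fin M)) :
    Fin K → EuclideanSpace ℂ (Fin M) :=
  rotIter (pivots t) (n + 1) H

/-- At each step of the triangularization the coordinate of the pivot that determines the phase in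
the Householder vector does not vanish. -/
def Nondegenerate {M K n : ℕ} (t : Fin (n + 1) → Fin K)
    (H : Fin K → EuclideanSpace ℂ (Fin M)) : Prop :=
  ∀ (i : ℕ) (m : Fin M), (m : ℕ) = i → rotIter (pivots t) i H (pivots t i) m ≠ 0

theorem ae_nondegenerate {M K n : ℕ} (t : Fin (n + 1) → Fin K) :
    ∀ᵐ H ∂(gaussianEnsemble K M), Nondegenerate t H := by
  refine ae_all_iff.2 fun i => ae_all_iff.2 fun m => ?_
  filter_upwards [(measurePreserving_rotIter (M := M) (pivots t) i).quasiMeasurePreserving.ae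
    (ae_apply_ne_zero (pivots t i) m)] with H hH _ using hH

theorem projEnergy_prevSpan_eq {M K n : ℕ} (hn : n < M) {t : Fin (n + 1) → Fin K}
    {H : Fin K → EuclideanSpace ℂ (Fin M)} (hH : Nondegenerate t H) (i : Fin (n + 1))
    (ht : ∀ l < i, ∀ j < l, t j ≠ t l) (k : Fin K) (hk : ∀ j < i, t j ≠ k) :
    projEnergy (prevSpan (fun j => H (t j)) i) (H k) = ‖tail M i (triang t H k)‖ ^ 2 := by
  have hcast : ∀ l (hl : l < (i : ℕ)), ∃ l' : Fin (n + 1), (l' : ℕ) = l ∧ l' < i := fun l hl =>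
    ⟨⟨l, hl.trans i.2⟩, rfl, hl⟩
  have hspan : prevSpan (fun j => H (t j)) i =
      Submodule.span ℂ ((fun l => H (pivots t l)) '' Iio (i : ℕ)) := by
    rw [prevSpan]
    congr 1
    ext x
    constructor
    · rintro ⟨j, hj, rfl⟩
      exact ⟨j, hj, by simp only [pivots_val]⟩
    · rintro ⟨l, hl, rfl⟩
      obtain ⟨l', rfl, hl'⟩ := hcast l hl
      exact ⟨l', hl', by simp only [pivots_val]⟩
  rw [hspan, triang]
  refine projEnergy_span_eq (pivots t) H (by omega) i.2.le ?_ (fun l hl => hH l _ rfl) k ?_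
  · intro l hl j hj
    obtain ⟨l', rfl, hl'⟩ := hcast l hl
    obtain ⟨j', rfl, hj'⟩ := hcast j (hj.trans hl)
    rw [pivots_val, pivots_val]
    exact ht l' hl' j' hj
  · intro l hl
    obtain ⟨l', rfl, hl'⟩ := hcast l hl
    rw [pivots_val]
    exact hk l' hl'

theorem isGreedy_triang {M K n : ℕ} (hn : n < M) {t : Fin (n + 1) → Fin K}
    {H : Fin K → EuclideanSpace ℂ (Fin M)} (hH : Nondegenerate t H) (hs : IsSUSSelection H t) :
    IsGreedy (triang t H) t := by
  intro i
  refine ⟨(hs i).1, fun k hk => ?_⟩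
  have ht : ∀ l < i, ∀ j < l, t j ≠ t l := fun l _ => (hs l).1
  rw [← projEnergy_prevSpan_eq hn hH i ht k hk,
    ← projEnergy_prevSpan_eq hn hH i ht (t i) (hs i).1]
  exact (hs i).2 k hk

/-- The energy of the selected user `t i`, read off the triangularized channels. -/
def selEnergy {M K n : ℕ} (i : Fin (n + 1)) (t : Fin (n + 1) → Fin K)
    (H : Fin K → EuclideanSpace ℂ (Fin M)) : ℝ :=
  ‖tail M i (triang t H (t i))‖ ^ 2

theorem measurable_selEnergy {M K n : ℕ} (i : Fin (n + 1)) (t : Fin (n + 1) → Fin K) :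
    Measurable (selEnergy (M := M) i t) :=
  ((measurable_tail i).comp ((measurable_pi_apply (t i)).comp
    (measurePreserving_rotIter (pivots t) (n + 1)).measurable)).norm.pow_const 2

/-- The mean of the inverse of the energy of the `(i + 1)`-st selected user is at most that of the
`(i + 1)`-st largest squared norm of `K` independent Gaussian vectors in dimension `M - i`. The
inverse is taken in `[0, ∞]`, where it is antitone also at `0`. -/
theorem lintegral_inv_selEnergy_le {M K n : ℕ} (hn : n < M) (hnK : n + 1 ≤ K) {Ω : Type*}
    [MeasurableSpace Ω] (P : Measure Ω) (H : Ω → Fin K → EuclideanSpace ℂ (Fin M))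
    (hH : AEMeasurable H P) (hlaw : P.map H = gaussianEnsemble K M)
    (s : Ω → Fin (n + 1) → Fin K)
    (hs : ∀ᵐ ω ∂P, IsSUSSelection (H ω) (s ω)) (i : Fin (n + 1)) :
    ∫⁻ ω, (ENNReal.ofReal (selEnergy i (s ω) (H ω)))⁻¹ ∂P ≤
      ∫⁻ g, (ENNReal.ofReal (normSqOrderStat (Fin.castLE hnK i) g))⁻¹
        ∂(gaussianVectors K (M - i)) := by
  classical
  let X : (Fin K → EuclideanSpace ℂ (Fin M)) → ℝ≥0∞ := fun G =>
    (ENNReal.ofReal (descOrderStat (fun k => ‖tail M i (G k)‖ ^ 2) (Fin.castLE hnK i)))⁻¹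
  have hXeq : ∀ G, X G = (ENNReal.ofReal (normSqOrderStat (Fin.castLE hnK i)
      (dropCoords i G)))⁻¹ := fun G => by
    simp only [X, normSqOrderStat, norm_dropCoords]
  have hXm : Measurable X := by
    rw [funext hXeq]
    exact ((measurable_normSqOrderStat _).comp
      (measurePreserving_dropCoords K M i).measurable).ennreal_ofReal.inv
  let A : (Fin (n + 1) → Fin K) → Set (Fin K → EuclideanSpace ℂ (Fin M)) := fun t =>
    {G | IsGreedy G t}
  have hA : ∀ t, MeasurableSet (A t) := measurableSet_isGreedy
  have hnd : ∀ᵐ ω ∂P, ∀ t : Fin (n + 1) → Fin K, Nondegenerate t (H ω) :=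
    ae_all_iff.2 fun t => ae_of_ae_map hH (hlaw ▸ ae_nondegenerate t)
  have htri : ∀ t : Fin (n + 1) → Fin K, MeasurePreserving (triang (M := M) t)
      (gaussianEnsemble K M) (gaussianEnsemble K M) := fun t =>
    measurePreserving_rotIter (pivots t) (n + 1)
  calc ∫⁻ ω, (ENNReal.ofReal (selEnergy i (s ω) (H ω)))⁻¹ ∂P
      ≤ ∫⁻ ω, (∑ t, (A t).indicator X (triang t (H ω))) ∂P := by
        -- the term of `t = s ω` suffices
        refine lintegral_mono_ae ?_
        filter_upwards [hs, hnd] with ω h1 h2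
        have hg := isGreedy_triang hn (h2 (s ω)) h1
        calc _ ≤ X (triang (s ω) (H ω)) :=
              ENNReal.inv_le_inv.2 (ENNReal.ofReal_le_ofReal (hg.descOrderStat_le hnK i))
          _ = (A (s ω)).indicator X (triang (s ω) (H ω)) := (indicator_of_mem hg X).symm
          _ ≤ _ := Finset.single_le_sum (f := fun t => (A t).indicator X (triang t (H ω)))
              (fun _ _ => zero_le) (Finset.mem_univ _)
    _ = ∫⁻ G, (∑ t, (A t).indicator X (triang t G)) ∂(gaussianEnsemble K M) := by
        have hms : Measurable fun G => ∑ t, (A t).indicator X (triang t G) :=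
          Finset.measurable_fun_sum _ fun t _ =>
            (hXm.indicator (hA t)).comp (htri t).measurable
        rw [← hlaw, lintegral_map' hms.aemeasurable hH]
    _ = ∑ t, ∫⁻ G, (A t).indicator X (triang t G) ∂(gaussianEnsemble K M) :=
        lintegral_finsetSum _ fun t _ => (hXm.indicator (hA t)).comp (htri t).measurable
    _ = ∑ t, ∫⁻ G, (A t).indicator X G ∂(gaussianEnsemble K M) :=
        Finset.sum_congr rfl fun t _ => (htri t).lintegral_comp (hXm.indicator (hA t))
    _ = ∫⁻ G, (∑ t, (A t).indicator X G) ∂(gaussianEnsemble K M) :=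
        (lintegral_finsetSum _ fun t _ => hXm.indicator (hA t)).symm
    _ ≤ ∫⁻ G, X G ∂(gaussianEnsemble K M) := by
        -- at most one `t` contributes, for lack of ties
        refine lintegral_mono_ae ?_
        have hinj : ∀ᵐ G ∂(gaussianEnsemble K M), ∀ l : Fin (n + 1),
            Function.Injective fun k => ‖tail M l (G k)‖ ^ 2 :=
          ae_all_iff.2 fun l => ae_injective_norm_tail (by omega)
        filter_upwards [hinj] with G hG
        by_cases h : ∃ t : Fin (n + 1) → Fin K, IsGreedy G t
        · obtain ⟨t, ht⟩ := h
          rw [Finset.sum_eq_single t]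
          · exact indicator_le_self _ _ _
          · intro t' _ hne
            exact indicator_of_notMem (fun ht' => hne (IsGreedy.unique hG ht' ht)) _
          · simp
        · rw [Finset.sum_eq_zero fun t _ => indicator_of_notMem (fun ht => h ⟨t, ht⟩) _]
          exact zero_le
    _ = _ := by
        simp only [hXeq]
        exact (measurePreserving_dropCoords K M i).lintegral_comp
          (measurable_normSqOrderStat _).ennreal_ofReal.inv

theorem aemeasurable_selEnergy {M K n : ℕ} {Ω : Type*}
    [MeasurableSpace Ω] (P : Measure Ω) (H : Ω → Fin K → EuclideanSpace ℂ (Fin M))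
    (hH : AEMeasurable H P) (s : Ω → Fin (n + 1) → Fin K) (hs_meas : Measurable s)
    (i : Fin (n + 1)) : AEMeasurable (fun ω => selEnergy i (s ω) (H ω)) P := by
  classical
  have : (fun ω => selEnergy i (s ω) (H ω)) =
      fun ω => ∑ t, (s ⁻¹' {t}).indicator (fun ω => selEnergy i t (H ω)) ω := by
    funext ω
    rw [Finset.sum_eq_single (s ω)]
    · rw [indicator_of_mem (mem_preimage.2 (mem_singleton (s ω)))]
    · intro t _ ht
      exact indicator_of_notMem (by simpa using ht.symm) _
    · simp
  rw [this]
  exact Finset.aemeasurable_fun_sum _ fun t _ =>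
    ((measurable_selEnergy i t).comp_aemeasurable hH).indicator
      (hs_meas (measurableSet_singleton t))

end SUSPower

end

open SUSPower in
theorem mainTheorem10 (M K : ℕ) (hM : 4 ≤ M) (hK : 4 < K)
    (σ γ : ℝ) (hσ : 0 < σ) (hγ : 0 < γ)
    {Ω : Type*} [MeasurableSpace Ω] (P : Measure Ω) [IsProbabilityMeasure P]
    (h : Fin K → Fin M → Ω → ℂ)
    (hindep : iIndepFun (fun p : Fin K × Fin M => h p.1 p.2) P)
    (hlaw : ∀ k m, HasLaw (h k m) SUSPower.stdComplexGaussian P)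
    (s : Fin 4 → Ω → Fin K) (hs_meas : ∀ i, Measurable (s i))
    (hs : ∀ᵐ ω ∂P, SUSPower.IsSUSSelection
      (fun k => (WithLp.toLp 2 (fun m => h k m ω) : EuclideanSpace ℂ (Fin M)))
      (fun i => s i ω)) :
    -- all the expectations and all the constants involved are finite
    (∀ i : Fin 4, Integrable
      (fun g => (SUSPower.normSqOrderStat (Fin.castLE hK.le i) g)⁻¹)
      (SUSPower.gaussianVectors K (M - i))) ∧
    (∀ i j : ℕ, i ≤ 3 → j ≤ i →
      IntegrableOn (SUSPower.alphaIntegrand (M - i) (K - j)) (Set.Ioi 0)) ∧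
    -- the explicit formula
    SUSPower.susAveragePower M K 4 hK.le σ γ = SUSPower.susFourFormula M K σ γ ∧
    -- it bounds the average power of the four users selected by the algorithm
    Integrable (fun ω => SUSPower.instPower σ γ
      (fun i => (WithLp.toLp 2 (fun m => h (s i ω) m ω) : EuclideanSpace ℂ (Fin M)))) P ∧
    ∫ ω, SUSPower.instPower σ γ
      (fun i => (WithLp.toLp 2 (fun m => h (s i ω) m ω) : EuclideanSpace ℂ (Fin M))) ∂P
      ≤ SUSPower.susFourFormula M K σ γ := by
  have hspec : ∀ i : Fin 4, _ := fun i => meanInvOrderStat_spec (m := M - i) (by omega) hK i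
  refine ⟨fun i => (hspec i).2.1, fun i j hi hj =>
    integrableOn_alphaIntegrand (by omega) (by omega) (Or.inr (by omega)), ?_, ?_⟩
  · rw [susFourFormula_eq_sum, susAveragePower]
    simp only [(hspec _).2.2]
  obtain ⟨hHm, hHlaw⟩ := map_channels P h hindep hlaw
  set H : Ω → Fin K → EuclideanSpace ℂ (Fin M) := fun ω k => WithLp.toLp 2 (fun m => h k m ω)
    with hH
  let s' : Ω → Fin 4 → Fin K := fun ω i => s i ω
  have hs' : Measurable s' := measurable_pi_lambda _ hs_meas
  have hm : ∀ i, AEMeasurable (fun ω => selEnergy i (s' ω) (H ω)) P :=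
    aemeasurable_selEnergy P H hHm s' hs'
  have hm' : ∀ i, AEMeasurable (fun ω => (ENNReal.ofReal (selEnergy i (s' ω) (H ω)))⁻¹) P :=
    fun i => (hm i).ennreal_ofReal.inv
  have hle : ∀ i : Fin 4, ∫⁻ ω, (ENNReal.ofReal (selEnergy i (s' ω) (H ω)))⁻¹ ∂P ≤
      ENNReal.ofReal (meanInvOrderStat (M - i) K i) := fun i => by
    rw [← (hspec i).1]
    exact lintegral_inv_selEnergy_le (by omega) hK.le P H hHm hHlaw s' hs i
  have hfin : ∀ i : Fin 4, ∫⁻ ω, (ENNReal.ofReal (selEnergy i (s' ω) (H ω)))⁻¹ ∂P ≠ ⊤ := fun i =>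
    ((hle i).trans_lt ENNReal.ofReal_lt_top).ne
  have hre : ∀ i ω, (selEnergy i (s' ω) (H ω))⁻¹ =
      ((ENNReal.ofReal (selEnergy i (s' ω) (H ω)))⁻¹).toReal := fun i ω => by
    have h0 : 0 ≤ selEnergy i (s' ω) (H ω) := by rw [selEnergy]; positivity
    rw [ENNReal.toReal_inv, ENNReal.toReal_ofReal h0]
  have hint : ∀ i, Integrable (fun ω => (selEnergy i (s' ω) (H ω))⁻¹) P := fun i => by
    simp only [hre]
    exact integrable_toReal_of_lintegral_ne_top (hm' i) (hfin i)
  have hnonneg : ∀ i : Fin 4, 0 ≤ meanInvOrderStat (M - i) K i := fun i => by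
    rw [← (hspec i).2.2]
    exact integral_nonneg fun g =>
      inv_nonneg.2 (descOrderStat_nonneg (fun k => by positivity) _)
  have hintle : ∀ i : Fin 4, ∫ ω, (selEnergy i (s' ω) (H ω))⁻¹ ∂P ≤ meanInvOrderStat (M - i) K i :=
    fun i => by
      simp only [hre]
      rw [integral_toReal (hm' i) (ae_lt_top' (hm' i) (hfin i))]
      exact ENNReal.toReal_le_of_le_ofReal (hnonneg i) (hle i)
  have hpow : (fun ω => instPower σ γ (fun i => H ω (s i ω))) =ᵐ[P]
      fun ω => σ ^ 2 * ∑ i : Fin 4, γ * (selEnergy i (s' ω) (H ω))⁻¹ := by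
    have hnd : ∀ᵐ ω ∂P, ∀ t : Fin 4 → Fin K, Nondegenerate t (H ω) :=
      ae_all_iff.2 fun t => ae_of_ae_map hHm (hHlaw ▸ ae_nondegenerate t)
    filter_upwards [hs, hnd] with ω h1 h2
    rw [instPower]
    congr 1
    refine Finset.sum_congr rfl fun i _ => ?_
    rw [div_eq_mul_inv, projEnergy_prevSpan_eq (t := s' ω) (by omega) (h2 (s' ω)) i
      (fun l _ => (h1 l).1) (s i ω) (h1 i).1]
    rfl
  have hint' : ∀ i ∈ Finset.univ, Integrable (fun ω => γ * (selEnergy i (s' ω) (H ω))⁻¹) P :=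
    fun i _ => (hint i).const_mul γ
  refine ⟨((integrable_finsetSum _ hint').const_mul (σ ^ 2)).congr hpow.symm, ?_⟩
  change ∫ ω, instPower σ γ (fun i => H ω (s i ω)) ∂P ≤ _
  rw [integral_congr_ae hpow, integral_const_mul, integral_finsetSum _ hint',
    susFourFormula_eq_sum, mul_assoc, Finset.mul_sum _ _ γ]
  refine mul_le_mul_of_nonneg_left (Finset.sum_le_sum fun i _ => ?_) (sq_nonneg σ)
  rw [integral_const_mul]
  exact mul_le_mul_of_nonneg_left (hintle i) hγ.le
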